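/- **Model.** For $\theta\in\mathbb R^d$ and $\sigma>0$ let $P_{\theta,\sigma}$ be the law of $(Y,X)\in\mathbb R\times\mathbb R^d$ with $Y=X^\top\theta+\epsilon$, where $X$ has a fixed distribution $P_X$ (not depending on the parameters) and $\epsilon\sim N(0,\sigma^2)$ is independent of $X$; let $p_{\theta,\sigma}$ be its density with respect to $\text{Lebesgue}\otimes P_X$, i.e. $p_{\theta,\sigma}(y,x)$ is the $N(x^\top\theta,\sigma^2)$ density at $y$. The data $Z_i=(Y_i,X_i)$, $i=1,\dots,n$, are i.i.d. from $P_{\theta_0,\sigma_0}$, and $L_n(\theta,\sigma)=\prod_{i=1}^n p_{\theta,\sigma}(Y_i,X_i)$. Write $s^*=\|\theta_0\|_0$ for the number of nonzero coordinates of $\theta_0$ and assume $1\le s^*<n<d$. **Prior and fractional posterior.** Let $C_1>0$ and $a>0$. The prior $\pi$ makes $\theta$ and $\sigma$ independent; $\theta$ has a density proportional to $\prod_{i=1}^d(\tau^2+\theta_i^2)^{-2}$ on the ball $\{\|\theta\|_1\le C_1\}$ (and $0$ outside), and $\sigma^2$ has the inverse-Gamma distribution $IG(a,b)$, i.e. density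 $\frac{b^a}{\Gamma(a)}v^{-a-1}e^{-b/v}$ on $v>0$. For $\alpha\in(0,1)$ the fractional posterior is $\Pi_{n,\alpha}(d\theta,d\sigma)\propto L_n(\theta,\sigma)^\alpha\,\pi(d\theta,d\sigma)$. **Assumptions.** $\mathbb E\|X_1\|_2^2<C_{\rm x}^2$ with $0<C_{\rm x}<\infty$; $(2\sigma_{\min})^{-1}<\sigma_0^2<(2\sigma_{\max})^{-1}$ with $\sigma_{\min},\sigma_{\max}>0$; $\tau=\frac{1}{C_{\rm x}\sqrt{nd}}$, $b=n^{-1/2}$; and $\|\theta_0\|_1\le C_1-2d\tau$. **Distances.** For probability measures $P,Q$ with densities $p,q$ with respect to a common dominating measure $\mu$, $H^2(P,Q)=\int(\sqrt p-\sqrt q)^2\,d\mu$ and $d_{TV}(P,Q)=\int|p-q|\,d\mu=2\sup_A|P(A)-Q(A)|$. Put $\kappa_\alpha=\frac{2(\alpha+1)}{1-\alpha}$ if $\alpha\in[\frac12,1)$ and $\kappa_\alpha=\frac{2(\alpha+1)}{\alpha}$ if $\alpha\in(0,\frac12)$. **Theorem.** For all $\sigma_{\min},\sigma_{\max},a>0$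 there is a constant $c>0$, depending only on $\sigma_{\min},\sigma_{\max},a$, such that for every $\alpha\in(0,1)$ and in every situation as above, with $$\varepsilon_n=\frac{c\,s^*\log\left(C_{\rm x}C_1\sqrt{nd}/s^*\right)}{n},$$ the event that both $$\int H^2(P_{\theta,\sigma},P_{\theta_0,\sigma_0})\,\Pi_{n,\alpha}(d\theta,d\sigma)\le\kappa_\alpha\,\varepsilon_n\quad\text{and}\quad\int d_{TV}^2(P_{\theta,\sigma},P_{\theta_0,\sigma_0})\,\Pi_{n,\alpha}(d\theta,d\sigma)\le\frac{4(\alpha+1)}{(1-\alpha)\alpha}\,\varepsilon_n$$ hold has probability at least $1-\frac{2}{n\varepsilon_n}$. -/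

import Mathlib

open MeasureTheory ProbabilityTheory

noncomputable section

namespace SparseRegression

/-- `ℝ^d` with the Euclidean norm. -/
abbrev Vec (d : ℕ) : Type := EuclideanSpace ℝ (Fin d)

/-- The `ℓ₁` norm. -/
def l1Norm {d : ℕ} (θ : Vec d) : ℝ := ∑ i, |θ i|

/-- The number of nonzero coordinates. -/
def l0Norm {d : ℕ} (θ : Vec d) : ℕ := (Finset.univ.filter fun i => θ i ≠ 0).card

/-! ### The model -/

/-- The law `P_{θ,σ}` of a pair `(Y, X)` with `Y = Xᵀθ + ε`, where the design `X` has law `PX`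
and the noise `ε ∼ N(0, σ²)` is independent of `X`. -/
def modelLaw {d : ℕ} (PX : Measure (Vec d)) (θ : Vec d) (σ : ℝ) : Measure (ℝ × Vec d) :=
  (PX.prod (gaussianReal 0 (σ ^ 2).toNNReal)).map fun p => (inner ℝ p.1 θ + p.2, p.1)

/-- The density `p_{θ,σ}(y, x)` of `P_{θ,σ}` with respect to `Lebesgue ⊗ PX`: the `N(xᵀθ, σ²)`
density at `y`. -/
def modelDensity {d : ℕ} (θ : Vec d) (σ : ℝ) (z : ℝ × Vec d) : ℝ :=
  gaussianPDFReal (inner ℝ z.2 θ) (σ ^ 2).toNNReal z.1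

/-- The likelihood `L_n(θ, σ)` of a sample of size `n`. -/
def likelihood {n d : ℕ} (z : Fin n → ℝ × Vec d) (θ : Vec d) (σ : ℝ) : ℝ :=
  ∏ i, modelDensity θ σ (z i)

/-! ### Prior and fractional posterior -/

/-- The measure `μ` divided by its total mass. -/
def normalized {T : Type*} [MeasurableSpace T] (μ : Measure T) : Measure T :=
  (μ Set.univ)⁻¹ • μ

/-- The scaled Student prior on `θ`: the probability measure on the `ℓ₁` ball of radius `C₁` with
Lebesgue density proportional to `∏ i, (τ² + θᵢ²)⁻²`. -/
def studentPrior (d : ℕ) (τ C₁ : ℝ) : Measure (Vec d) :=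
  normalized ((volume.restrict {θ : Vec d | l1Norm θ ≤ C₁}).withDensity
    fun θ => ENNReal.ofReal (∏ i, ((τ ^ 2 + θ i ^ 2) ^ 2)⁻¹))

/-- The inverse-Gamma distribution with shape `a` and scale `b`. -/
def inverseGamma (a b : ℝ) : Measure ℝ :=
  (volume.restrict (Set.Ioi 0)).withDensity fun v =>
    ENNReal.ofReal (b ^ a / Real.Gamma a * v ^ (-a - 1) * Real.exp (-b / v))

/-- The prior on `(θ, σ)`: `θ` and `σ` are independent, `θ` has the scaled Student prior, and
`σ > 0` with `σ² ∼ IG(a, b)`. -/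
def prior (d : ℕ) (τ C₁ a b : ℝ) : Measure (Vec d × ℝ) :=
  (studentPrior d τ C₁).prod ((inverseGamma a b).map Real.sqrt)

/-- The fractional posterior `Π_{n,α}(dθ, dσ) ∝ L_n(θ, σ)^α π(dθ, dσ)`. -/
def fractionalPosterior {n d : ℕ} (π : Measure (Vec d × ℝ)) (α : ℝ) (z : Fin n → ℝ × Vec d) :
    Measure (Vec d × ℝ) :=
  normalized (π.withDensity fun p => ENNReal.ofReal (likelihood z p.1 p.2 ^ α))

/-! ### Distances between probability measures

Densities are taken with respect to the dominating measure `P + Q`. -/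

/-- The squared Hellinger distance `∫ (√p - √q)² dμ`. -/
def hellingerSq {T : Type*} [MeasurableSpace T] (P Q : Measure T) : ℝ :=
  ∫ x, (√(P.rnDeriv (P + Q) x).toReal - √(Q.rnDeriv (P + Q) x).toReal) ^ 2 ∂(P + Q)

/-- The total variation distance `∫ |p - q| dμ`, which is `2 * sup_A |P A - Q A|`. -/
def tvDist {T : Type*} [MeasurableSpace T] (P Q : Measure T) : ℝ :=
  ∫ x, |(P.rnDeriv (P + Q) x).toReal - (Q.rnDeriv (P + Q) x).toReal| ∂(P + Q)

/-! ### Rate and constants -/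

/-- `ε_n = c s* log(Cx C₁ √(n d) / s*) / n`. -/
def rate (c : ℝ) (n d s : ℕ) (Cx C₁ : ℝ) : ℝ :=
  c * s * Real.log (Cx * C₁ * √(n * d) / s) / n

/-- `κ_α`. -/
def kappa (α : ℝ) : ℝ :=
  if 1 / 2 ≤ α then 2 * (α + 1) / (1 - α) else 2 * (α + 1) / α

end SparseRegression

end

/-! Write r for the likelihood ratio against the truth, D for the prior integral of r^α, and m = min
α (1 - α). A sharpened weighted AM-GM inequality (`rpow_mul_rpow_add_le`) bounds the affinity ∫ p^α
q^(1-α) by exp(-m H²), so r^α exp(n m H²) has mean at most 1 at each parameter with σ > 0. By Fubini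
its prior integral G also has mean at most 1 (`lintegral_exponentialMoment_le`), and Markov gives G
≤ exp(nε/2) off an event of probability 1/(nε). The posterior mean of exp(n m H²) is G/D; a tangent
line to the exponential turns this into a bound on the posterior mean of H² once D is bounded below
(`lintegral_normalized_withDensity_le`). Total variation follows from d_TV² ≤ 4 H².

The lower bound on D is pointwise in the data. For σ² in [σ₀², (1 + 1/n) σ₀²] the log-ratio at θ₀ +
δ is at least a constant plus a linear form minus a quadratic form in δ (`likelihoodRatio_ge`).
Since Student tails are polynomial, the prior dominates a product Student law of scale ητ, recentred
at θ₀ and truncated, at a cost of 4 ∑ log(1 + |θ₀ᵢ|/τ) - 4 d log η in the exponent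
(`studentWeight_add_ge`, `lintegral_studentPrior_ge`). Zero coordinates of θ₀ do not enter the sum,
and concavity of log bounds it by order s* log R with R = Cx C₁ √(nd) / s*.

The Student law is symmetric, so averaging over ±δ removes the linear form, which carries all the
noise (`setLIntegral_exp_inner_sub_ge`). The only random quantity left is ∑ ‖Xᵢ‖², handled by Markov
with a second 1/(nε). -/

noncomputable section

namespace SparseRegression

/-! ### Hellinger and total variation distances through a dominating measure -/

section Distances

variable {T : Type*} [MeasurableSpace T]

/-- Positive homogeneity of degree one makes such a functional independent of the dominating
measure, by the chain rule for Radon–Nikodym derivatives. It serves both distances. -/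
lemma integral_add_measure_eq_integral_of_ac {P Q μ : Measure T} [IsFiniteMeasure P]
    [IsFiniteMeasure Q] [SigmaFinite μ] (hP : P ≪ μ) (hQ : Q ≪ μ) (F : ℝ → ℝ → ℝ)
    (hF : ∀ s x y, 0 ≤ s → 0 ≤ x → 0 ≤ y → s * F x y = F (x * s) (y * s)) :
    ∫ x, F (P.rnDeriv (P + Q) x).toReal (Q.rnDeriv (P + Q) x).toReal ∂(P + Q)
      = ∫ x, F (P.rnDeriv μ x).toReal (Q.rnDeriv μ x).toReal ∂μ := by
  have hPQ : P + Q ≪ μ := Measure.AbsolutelyContinuous.add_left hP hQ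
  rw [← integral_toReal_rnDeriv_mul hPQ]
  have h1 : P ≪ P + Q := Measure.AbsolutelyContinuous.rfl.add_right _
  have h2 : Q ≪ P + Q := Measure.AbsolutelyContinuous.rfl.add_right' _
  refine integral_congr_ae ?_
  filter_upwards [Measure.rnDeriv_mul_rnDeriv h1 (κ := μ),
    Measure.rnDeriv_mul_rnDeriv h2 (κ := μ)] with x hx hy
  rw [hF _ _ _ ENNReal.toReal_nonneg ENNReal.toReal_nonneg ENNReal.toReal_nonneg, ← hx, ← hy]
  simp

lemma hellingerSq_eq_of_ac {P Q μ : Measure T} [IsFiniteMeasure P]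
    [IsFiniteMeasure Q] [SigmaFinite μ] (hP : P ≪ μ) (hQ : Q ≪ μ) :
    hellingerSq P Q
      = ∫ x, (√(P.rnDeriv μ x).toReal - √(Q.rnDeriv μ x).toReal) ^ 2 ∂μ := by
  refine integral_add_measure_eq_integral_of_ac hP hQ (fun x y => (√x - √y) ^ 2) ?_
  intro s x y hs hx hy
  simp only [Real.sqrt_mul hx, Real.sqrt_mul hy, ← sub_mul, mul_pow, Real.sq_sqrt hs]
  ring

lemma tvDist_eq_of_ac {P Q μ : Measure T} [IsFiniteMeasure P]
    [IsFiniteMeasure Q] [SigmaFinite μ] (hP : P ≪ μ) (hQ : Q ≪ μ) :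
    tvDist P Q = ∫ x, |(P.rnDeriv μ x).toReal - (Q.rnDeriv μ x).toReal| ∂μ := by
  refine integral_add_measure_eq_integral_of_ac hP hQ (fun x y => |x - y|) ?_
  intro s x y hs hx hy
  simp only [← sub_mul, abs_mul, abs_of_nonneg hs]
  ring

lemma rnDeriv_withDensity_ofReal_toReal {μ : Measure T} [SigmaFinite μ] {p : T → ℝ}
    (hp : Measurable p) (h0 : ∀ x, 0 ≤ p x) :
    (fun x => ((μ.withDensity fun x => ENNReal.ofReal (p x)).rnDeriv μ x).toReal) =ᵐ[μ] p := by
  filter_upwards [Measure.rnDeriv_withDensity μ (f := fun x => ENNReal.ofReal (p x))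
    (by fun_prop)] with x hx
  rw [hx, ENNReal.toReal_ofReal (h0 x)]

lemma hellingerSq_withDensity {μ : Measure T} [SigmaFinite μ] {p q : T → ℝ}
    (hp : Measurable p) (hq : Measurable q) (hp0 : ∀ x, 0 ≤ p x) (hq0 : ∀ x, 0 ≤ q x)
    (hpi : Integrable p μ) (hqi : Integrable q μ) :
    hellingerSq (μ.withDensity fun x => ENNReal.ofReal (p x))
      (μ.withDensity fun x => ENNReal.ofReal (q x)) = ∫ x, (√(p x) - √(q x)) ^ 2 ∂μ := by
  have := isFiniteMeasure_withDensity_ofReal hpi.2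
  have := isFiniteMeasure_withDensity_ofReal hqi.2
  rw [hellingerSq_eq_of_ac (withDensity_absolutelyContinuous _ _)
    (withDensity_absolutelyContinuous _ _)]
  refine integral_congr_ae ?_
  filter_upwards [rnDeriv_withDensity_ofReal_toReal (μ := μ) hp hp0,
    rnDeriv_withDensity_ofReal_toReal (μ := μ) hq hq0] with x hx hy
  rw [hx, hy]

lemma tvDist_withDensity {μ : Measure T} [SigmaFinite μ] {p q : T → ℝ}
    (hp : Measurable p) (hq : Measurable q) (hp0 : ∀ x, 0 ≤ p x) (hq0 : ∀ x, 0 ≤ q x)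
    (hpi : Integrable p μ) (hqi : Integrable q μ) :
    tvDist (μ.withDensity fun x => ENNReal.ofReal (p x))
      (μ.withDensity fun x => ENNReal.ofReal (q x)) = ∫ x, |p x - q x| ∂μ := by
  have := isFiniteMeasure_withDensity_ofReal hpi.2
  have := isFiniteMeasure_withDensity_ofReal hqi.2
  rw [tvDist_eq_of_ac (withDensity_absolutelyContinuous _ _)
    (withDensity_absolutelyContinuous _ _)]
  refine integral_congr_ae ?_
  filter_upwards [rnDeriv_withDensity_ofReal_toReal (μ := μ) hp hp0,
    rnDeriv_withDensity_ofReal_toReal (μ := μ) hq hq0] with x hx hy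
  rw [hx, hy]

lemma integrable_sq_sqrt_sub_sqrt {μ : Measure T} {p q : T → ℝ}
    (hp : Measurable p) (hq : Measurable q) (hp0 : ∀ x, 0 ≤ p x) (hq0 : ∀ x, 0 ≤ q x)
    (hpi : Integrable p μ) (hqi : Integrable q μ) :
    Integrable (fun x => (√(p x) - √(q x)) ^ 2) μ := by
  refine (hpi.add hqi).mono' (by fun_prop) (.of_forall fun x => ?_)
  rw [Real.norm_of_nonneg (sq_nonneg _), Pi.add_apply]
  nlinarith [Real.sq_sqrt (hp0 x), Real.sq_sqrt (hq0 x),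
    mul_nonneg (Real.sqrt_nonneg (p x)) (Real.sqrt_nonneg (q x))]

/-- `(∫ |p - q|)² ≤ 4 ∫ (√p - √q)²` for probability densities. -/
lemma sq_integral_abs_sub_le {μ : Measure T} {p q : T → ℝ}
    (hp : Measurable p) (hq : Measurable q) (hp0 : ∀ x, 0 ≤ p x) (hq0 : ∀ x, 0 ≤ q x)
    (hpi : Integrable p μ) (hqi : Integrable q μ) (hp1 : ∫ x, p x ∂μ = 1)
    (hq1 : ∫ x, q x ∂μ = 1) :
    (∫ x, |p x - q x| ∂μ) ^ 2 ≤ 4 * ∫ x, (√(p x) - √(q x)) ^ 2 ∂μ := by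
  set h := ∫ x, (√(p x) - √(q x)) ^ 2 ∂μ with hh
  set t := ∫ x, |p x - q x| ∂μ with ht
  have hint := integrable_sq_sqrt_sub_sqrt hp hq hp0 hq0 hpi hqi
  have hh0 : 0 ≤ h := integral_nonneg fun x => sq_nonneg _
  have ht0 : 0 ≤ t := integral_nonneg fun x => abs_nonneg _
  -- Cauchy–Schwarz in linearised form: 2ab ≤ a² + b² with a = l|√p - √q| and b = √p + √q, whose
  -- square is at most 2p + 2q. The choice l = t / h is optimal; when h = 0, l = 4 / t forces t = 0.
  have key : ∀ l : ℝ, 0 ≤ l → 2 * l * t ≤ l ^ 2 * h + 4 := by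
    intro l hl
    have e1 : l ^ 2 * h + 4
        = ∫ x, (l ^ 2 * (√(p x) - √(q x)) ^ 2 + (2 * p x + 2 * q x)) ∂μ := by
      have hpq : Integrable (fun x => 2 * p x + 2 * q x) μ :=
        (hpi.const_mul _).add (hqi.const_mul _)
      rw [integral_add (hint.const_mul _) hpq, integral_const_mul, integral_add (hpi.const_mul _) (hqi.const_mul _),
        integral_const_mul, integral_const_mul, hp1, hq1]
      ring
    rw [e1, ht, ← integral_const_mul]
    refine integral_mono (((hpi.sub hqi).abs).const_mul _)
      ((hint.const_mul _).add ((hpi.const_mul _).add (hqi.const_mul _))) fun x => ?_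
    have hx := Real.sq_sqrt (hp0 x)
    have hy := Real.sq_sqrt (hq0 x)
    have ha := Real.sqrt_nonneg (p x)
    have hb := Real.sqrt_nonneg (q x)
    have e2 : |p x - q x| = |√(p x) - √(q x)| * (√(p x) + √(q x)) := by
      rw [← abs_of_nonneg (add_nonneg ha hb), ← abs_mul]
      congr 1
      nlinarith
    have e3 := sq_abs (√(p x) - √(q x))
    simp only [e2]
    nlinarith [sq_nonneg (l * |√(p x) - √(q x)| - (√(p x) + √(q x))),
      sq_nonneg (√(p x) - √(q x))]
  rcases hh0.eq_or_lt with h0 | h0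
  · rw [← h0] at key ⊢
    by_contra! hc
    have htp : 0 < t := lt_of_le_of_ne ht0 fun h => by simp [← h] at hc
    have := key (4 / t) (by positivity)
    have e : 2 * (4 / t) * t = 8 := by field_simp; norm_num
    linarith
  · have := key (t / h) (by positivity)
    have e : 2 * (t / h) * t = 2 * (t ^ 2 / h) := by ring
    have e' : (t / h) ^ 2 * h = t ^ 2 / h := by field_simp
    rw [e, e'] at this
    have h4 : t ^ 2 / h ≤ 4 := by linarith
    rwa [div_le_iff₀ h0] at h4

/-- For an exponent β ≤ 1/2, apply weighted AM-GM to √(pq) and q with weights 2β and 1 - 2β; then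
2β√(pq) = βp + βq - β(√p - √q)² produces the Hellinger term. The other case swaps p and q. -/
lemma rpow_mul_rpow_add_le {α p q : ℝ} (hα0 : 0 < α) (hα1 : α < 1) (hp : 0 ≤ p) (hq : 0 ≤ q) :
    p ^ α * q ^ (1 - α) + min α (1 - α) * (√p - √q) ^ 2 ≤ α * p + (1 - α) * q := by
  have aux : ∀ {β p q : ℝ}, 0 < β → β ≤ 1 / 2 → 0 ≤ p → 0 ≤ q →
      p ^ β * q ^ (1 - β) + β * (√p - √q) ^ 2 ≤ β * p + (1 - β) * q := by
    intro β p q h0 h1 hp hq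
    have h := Real.geom_mean_le_arith_mean2_weighted (w₁ := 2 * β) (w₂ := 1 - 2 * β)
      (p₁ := √p * √q) (p₂ := q) (by linarith) (by linarith) (by positivity) hq (by ring)
    have e : (√p * √q) ^ (2 * β) * q ^ (1 - 2 * β) = p ^ β * q ^ (1 - β) := by
      rw [Real.mul_rpow (Real.sqrt_nonneg _) (Real.sqrt_nonneg _), Real.rpow_mul
        (Real.sqrt_nonneg _), Real.rpow_mul (Real.sqrt_nonneg _), Real.rpow_two, Real.rpow_two,
        Real.sq_sqrt hp, Real.sq_sqrt hq, mul_assoc]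
      congr 1
      rcases hq.eq_or_lt with rfl | hq
      · rw [Real.zero_rpow h0.ne', Real.zero_rpow (by linarith : 1 - β ≠ 0)]; simp
      · rw [← Real.rpow_add hq]; congr 1; ring
    rw [e] at h
    nlinarith [Real.sq_sqrt hp, Real.sq_sqrt hq]
  rcases le_total α (1 / 2) with h | h
  · rw [min_eq_left (by linarith)]
    exact aux hα0 h hp hq
  · rw [min_eq_right (by linarith)]
    have := aux (β := 1 - α) (p := q) (q := p) (by linarith) (by linarith) hq hp
    rw [sub_sub_cancel] at this
    nlinarith

/-- The Hellinger affinity of order `α` is controlled by the Hellinger distance. -/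
lemma lintegral_rpow_mul_rpow_le {μ : Measure T} {p q : T → ℝ} {α : ℝ} (hα0 : 0 < α)
    (hα1 : α < 1) (hp : Measurable p) (hq : Measurable q) (hp0 : ∀ x, 0 ≤ p x)
    (hq0 : ∀ x, 0 ≤ q x) (hpi : Integrable p μ) (hqi : Integrable q μ)
    (hp1 : ∫ x, p x ∂μ = 1) (hq1 : ∫ x, q x ∂μ = 1) :
    ∫⁻ x, ENNReal.ofReal (p x ^ α * q x ^ (1 - α)) ∂μ
      ≤ ENNReal.ofReal (Real.exp (-(min α (1 - α) * ∫ x, (√(p x) - √(q x)) ^ 2 ∂μ))) := by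
  have hint := integrable_sq_sqrt_sub_sqrt hp hq hp0 hq0 hpi hqi
  have hm : 0 ≤ min α (1 - α) := le_min hα0.le (by linarith)
  have hpt := fun x => rpow_mul_rpow_add_le hα0 hα1 (hp0 x) (hq0 x)
  have hn : ∀ x, 0 ≤ p x ^ α * q x ^ (1 - α) := fun x =>
    mul_nonneg (Real.rpow_nonneg (hp0 x) _) (Real.rpow_nonneg (hq0 x) _)
  have hA : Integrable (fun x => p x ^ α * q x ^ (1 - α)) μ := by
    refine ((hpi.const_mul α).add (hqi.const_mul (1 - α))).mono' (by fun_prop)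
      (.of_forall fun x => ?_)
    rw [Real.norm_of_nonneg (hn x)]
    have := hpt x
    simp only [Pi.add_apply]
    nlinarith [mul_nonneg hm (sq_nonneg (√(p x) - √(q x)))]
  rw [← ofReal_integral_eq_lintegral_ofReal hA (.of_forall hn)]
  refine ENNReal.ofReal_le_ofReal ?_
  have h1 : ∫ x, (p x ^ α * q x ^ (1 - α) + min α (1 - α) * (√(p x) - √(q x)) ^ 2) ∂μ
      ≤ ∫ x, (α * p x + (1 - α) * q x) ∂μ :=
    integral_mono (hA.add (hint.const_mul _)) ((hpi.const_mul α).add (hqi.const_mul (1 - α))) hpt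
  rw [integral_add hA (hint.const_mul _), integral_add (hpi.const_mul _) (hqi.const_mul _),
    integral_const_mul, integral_const_mul, integral_const_mul, hp1, hq1] at h1
  have := Real.add_one_le_exp (-(min α (1 - α) * ∫ x, (√(p x) - √(q x)) ^ 2 ∂μ))
  linarith

end Distances

/-! ### The regression model -/

section Model

variable {d : ℕ}

lemma measurable_modelDensity_uncurry :
    Measurable fun x : (Vec d × ℝ) × (ℝ × Vec d) => modelDensity x.1.1 x.1.2 x.2 := by
  unfold modelDensity
  exact measurable_uncurry_gaussianPDFReal.comp
    (f := fun x : (Vec d × ℝ) × (ℝ × Vec d) =>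
      ((inner ℝ x.2.2 x.1.1 : ℝ), (x.1.2 ^ 2).toNNReal, x.2.1)) (by fun_prop)

lemma measurable_modelDensity (θ : Vec d) (σ : ℝ) : Measurable (modelDensity θ σ) :=
  (measurable_modelDensity_uncurry (d := d)).comp
    (f := fun z : ℝ × Vec d => ((θ, σ), z)) (by fun_prop)

lemma modelDensity_nonneg (θ : Vec d) (σ : ℝ) (z : ℝ × Vec d) : 0 ≤ modelDensity θ σ z :=
  gaussianPDFReal_nonneg _ _ _

lemma toNNReal_sq_ne_zero {σ : ℝ} (hσ : 0 < σ) : (σ ^ 2).toNNReal ≠ 0 := by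
  simp [hσ.ne']

lemma modelDensity_pos (θ : Vec d) {σ : ℝ} (hσ : 0 < σ) (z : ℝ × Vec d) :
    0 < modelDensity θ σ z :=
  gaussianPDFReal_pos _ _ _ (toNNReal_sq_ne_zero hσ)

lemma modelDensity_eq (θ : Vec d) {σ : ℝ} (hσ : 0 < σ) (z : ℝ × Vec d) :
    modelDensity θ σ z
      = (√(2 * Real.pi))⁻¹ * σ⁻¹ * Real.exp (-(z.1 - inner ℝ z.2 θ) ^ 2 / (2 * σ ^ 2)) := by
  rw [modelDensity, gaussianPDFReal, Real.coe_toNNReal _ (sq_nonneg σ),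
    Real.sqrt_mul (by positivity), Real.sqrt_sq hσ.le, mul_inv]

lemma modelLaw_eq_withDensity (PX : Measure (Vec d)) [IsProbabilityMeasure PX] (θ : Vec d)
    {σ : ℝ} (hσ : 0 < σ) :
    modelLaw PX θ σ
      = ((volume : Measure ℝ).prod PX).withDensity
          fun z => ENNReal.ofReal (modelDensity θ σ z) := by
  refine Measure.ext_of_lintegral _ fun f hf => ?_
  have hd := (measurable_modelDensity θ σ).ennreal_ofReal
  have hm : Measurable fun p : Vec d × ℝ => ((inner ℝ p.1 θ : ℝ) + p.2, p.1) := by fun_prop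
  rw [modelLaw, lintegral_map hf hm, lintegral_prod (fun p : Vec d × ℝ => f ((inner ℝ p.1 θ : ℝ) + p.2, p.1))
    (hf.comp hm).aemeasurable,
    lintegral_withDensity_eq_lintegral_mul _ hd hf, lintegral_prod_symm _ (hd.mul hf).aemeasurable]
  refine lintegral_congr fun x => ?_
  have h1 := gaussianReal_map_const_add (μ := 0) (v := (σ ^ 2).toNNReal) (inner ℝ x θ : ℝ)
  have h2 : Measurable fun y : ℝ => f (y, x) := hf.comp (by fun_prop)
  rw [zero_add] at h1
  rw [← lintegral_map (f := fun y : ℝ => f (y, x)) (g := fun e => (inner ℝ x θ : ℝ) + e) h2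
    (by fun_prop), h1, gaussianReal_of_var_ne_zero _ (toNNReal_sq_ne_zero hσ),
    lintegral_withDensity_eq_lintegral_mul _ (measurable_gaussianPDF _ _) h2]
  rfl

instance isProbabilityMeasure_modelLaw (PX : Measure (Vec d)) [IsProbabilityMeasure PX]
    (θ : Vec d) (σ : ℝ) : IsProbabilityMeasure (modelLaw PX θ σ) :=
  Measure.isProbabilityMeasure_map (by fun_prop)

lemma lintegral_modelDensity (PX : Measure (Vec d)) [IsProbabilityMeasure PX] (θ : Vec d)
    {σ : ℝ} (hσ : 0 < σ) :
    ∫⁻ z, ENNReal.ofReal (modelDensity θ σ z) ∂((volume : Measure ℝ).prod PX) = 1 := by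
  have := measure_univ (μ := modelLaw PX θ σ)
  rwa [modelLaw_eq_withDensity PX θ hσ, withDensity_apply _ .univ, Measure.restrict_univ] at this

lemma integrable_modelDensity (PX : Measure (Vec d)) [IsProbabilityMeasure PX] (θ : Vec d)
    {σ : ℝ} (hσ : 0 < σ) :
    Integrable (modelDensity θ σ) ((volume : Measure ℝ).prod PX) := by
  refine (lintegral_ofReal_ne_top_iff_integrable
    (measurable_modelDensity θ σ).aestronglyMeasurable
    (.of_forall (modelDensity_nonneg θ σ))).1 ?_
  rw [lintegral_modelDensity PX θ hσ]
  exact ENNReal.one_ne_top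

lemma integral_modelDensity (PX : Measure (Vec d)) [IsProbabilityMeasure PX] (θ : Vec d)
    {σ : ℝ} (hσ : 0 < σ) :
    ∫ z, modelDensity θ σ z ∂((volume : Measure ℝ).prod PX) = 1 := by
  rw [integral_eq_lintegral_of_nonneg_ae (.of_forall (modelDensity_nonneg θ σ))
    (measurable_modelDensity θ σ).aestronglyMeasurable, lintegral_modelDensity PX θ hσ]
  rfl

/-- The squared Hellinger distance between `P_{θ,σ}` and `P_{θ₀,σ₀}` in terms of densities. -/
def modelHellinger (PX : Measure (Vec d)) (θ₀ : Vec d) (σ₀ : ℝ) (p : Vec d × ℝ) : ℝ :=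
  ∫ z, (√(modelDensity p.1 p.2 z) - √(modelDensity θ₀ σ₀ z)) ^ 2 ∂((volume : Measure ℝ).prod PX)

lemma modelHellinger_nonneg (PX : Measure (Vec d)) (θ₀ : Vec d) (σ₀ : ℝ) (p : Vec d × ℝ) :
    0 ≤ modelHellinger PX θ₀ σ₀ p :=
  integral_nonneg fun _ => sq_nonneg _

/-- This is the reason for working with `modelHellinger`: `hellingerSq` uses derivatives with
respect to a measure that varies with the parameter, while the integral of explicit densities is
visibly measurable in the parameter. -/
lemma measurable_modelHellinger (PX : Measure (Vec d)) [IsProbabilityMeasure PX] (θ₀ : Vec d)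
    (σ₀ : ℝ) : Measurable (modelHellinger PX θ₀ σ₀) := by
  have h1 := measurable_modelDensity_uncurry (d := d)
  have h2 := measurable_modelDensity θ₀ σ₀
  have h3 : Measurable fun x : (Vec d × ℝ) × (ℝ × Vec d) =>
      (√(modelDensity x.1.1 x.1.2 x.2) - √(modelDensity θ₀ σ₀ x.2)) ^ 2 := by fun_prop
  exact h3.stronglyMeasurable.integral_prod_right.measurable

lemma hellingerSq_modelLaw (PX : Measure (Vec d)) [IsProbabilityMeasure PX] (θ₀ : Vec d)
    {σ₀ : ℝ} (hσ₀ : 0 < σ₀) (θ : Vec d) {σ : ℝ} (hσ : 0 < σ) :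
    hellingerSq (modelLaw PX θ σ) (modelLaw PX θ₀ σ₀) = modelHellinger PX θ₀ σ₀ (θ, σ) := by
  rw [modelLaw_eq_withDensity PX θ hσ, modelLaw_eq_withDensity PX θ₀ hσ₀]
  exact hellingerSq_withDensity (measurable_modelDensity _ _) (measurable_modelDensity _ _)
    (modelDensity_nonneg _ _) (modelDensity_nonneg _ _) (integrable_modelDensity PX θ hσ)
    (integrable_modelDensity PX θ₀ hσ₀)

lemma tvDist_modelLaw_sq_le (PX : Measure (Vec d)) [IsProbabilityMeasure PX] (θ₀ : Vec d)
    {σ₀ : ℝ} (hσ₀ : 0 < σ₀) (θ : Vec d) {σ : ℝ} (hσ : 0 < σ) :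
    tvDist (modelLaw PX θ σ) (modelLaw PX θ₀ σ₀) ^ 2 ≤ 4 * modelHellinger PX θ₀ σ₀ (θ, σ) := by
  rw [modelLaw_eq_withDensity PX θ hσ, modelLaw_eq_withDensity PX θ₀ hσ₀,
    tvDist_withDensity (measurable_modelDensity _ _) (measurable_modelDensity _ _)
    (modelDensity_nonneg _ _) (modelDensity_nonneg _ _) (integrable_modelDensity PX θ hσ)
    (integrable_modelDensity PX θ₀ hσ₀)]
  exact sq_integral_abs_sub_le (measurable_modelDensity _ _) (measurable_modelDensity _ _)
    (modelDensity_nonneg _ _) (modelDensity_nonneg _ _) (integrable_modelDensity PX θ hσ)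
    (integrable_modelDensity PX θ₀ hσ₀) (integral_modelDensity PX θ hσ)
    (integral_modelDensity PX θ₀ hσ₀)

/-- The `α`-th moment of the likelihood ratio of one observation. -/
lemma lintegral_density_ratio_rpow_le (PX : Measure (Vec d)) [IsProbabilityMeasure PX]
    (θ₀ : Vec d) {σ₀ : ℝ} (hσ₀ : 0 < σ₀) (θ : Vec d) {σ : ℝ} (hσ : 0 < σ) {α : ℝ}
    (hα0 : 0 < α) (hα1 : α < 1) :
    ∫⁻ z, ENNReal.ofReal ((modelDensity θ σ z / modelDensity θ₀ σ₀ z) ^ α) ∂(modelLaw PX θ₀ σ₀)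
      ≤ ENNReal.ofReal (Real.exp (-(min α (1 - α) * modelHellinger PX θ₀ σ₀ (θ, σ)))) := by
  have h1 := measurable_modelDensity θ σ
  have h2 := measurable_modelDensity θ₀ σ₀
  rw [modelLaw_eq_withDensity PX θ₀ hσ₀, lintegral_withDensity_eq_lintegral_mul _
    h2.ennreal_ofReal (by fun_prop)]
  refine le_of_eq_of_le (lintegral_congr fun z => ?_)
    (lintegral_rpow_mul_rpow_le hα0 hα1 h1 h2
    (modelDensity_nonneg _ _) (modelDensity_nonneg _ _) (integrable_modelDensity PX θ hσ)
    (integrable_modelDensity PX θ₀ hσ₀) (integral_modelDensity PX θ hσ)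
    (integral_modelDensity PX θ₀ hσ₀))
  have hz := modelDensity_pos θ₀ hσ₀ z
  rw [Pi.mul_apply, ← ENNReal.ofReal_mul hz.le, Real.div_rpow (modelDensity_nonneg _ _ _) hz.le,
    Real.rpow_sub hz, Real.rpow_one]
  congr 1
  ring

/-- The likelihood ratio of a sample. -/
def likelihoodRatio {n : ℕ} (θ₀ : Vec d) (σ₀ : ℝ) (z : Fin n → ℝ × Vec d) (p : Vec d × ℝ) : ℝ :=
  ∏ i, modelDensity p.1 p.2 (z i) / modelDensity θ₀ σ₀ (z i)

lemma likelihoodRatio_nonneg {n : ℕ} (θ₀ : Vec d) (σ₀ : ℝ) (z : Fin n → ℝ × Vec d)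
    (p : Vec d × ℝ) : 0 ≤ likelihoodRatio θ₀ σ₀ z p :=
  Finset.prod_nonneg fun _ _ => div_nonneg (modelDensity_nonneg _ _ _) (modelDensity_nonneg _ _ _)

lemma measurable_likelihoodRatio {n : ℕ} (θ₀ : Vec d) (σ₀ : ℝ) :
    Measurable fun x : (Fin n → ℝ × Vec d) × (Vec d × ℝ) =>
      likelihoodRatio θ₀ σ₀ x.1 x.2 := by
  unfold likelihoodRatio
  refine Finset.measurable_prod _ fun i _ => ?_
  have h1 : Measurable fun x : (Fin n → ℝ × Vec d) × (Vec d × ℝ) =>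
      modelDensity x.2.1 x.2.2 (x.1 i) :=
    measurable_modelDensity_uncurry.comp
      (f := fun x : (Fin n → ℝ × Vec d) × (Vec d × ℝ) => (x.2, x.1 i)) (by fun_prop)
  have h2 := measurable_modelDensity θ₀ σ₀
  fun_prop

lemma likelihood_eq_mul_ratio {n : ℕ} (θ₀ : Vec d) {σ₀ : ℝ} (hσ₀ : 0 < σ₀)
    (z : Fin n → ℝ × Vec d) (p : Vec d × ℝ) :
    likelihood z p.1 p.2 = likelihood z θ₀ σ₀ * likelihoodRatio θ₀ σ₀ z p := by
  simp only [likelihood, likelihoodRatio, ← Finset.prod_mul_distrib]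
  refine Finset.prod_congr rfl fun i _ => ?_
  rw [mul_div_cancel₀ _ (modelDensity_pos θ₀ hσ₀ (z i)).ne']

lemma likelihood_pos {n : ℕ} (θ : Vec d) {σ : ℝ} (hσ : 0 < σ) (z : Fin n → ℝ × Vec d) :
    0 < likelihood z θ σ :=
  Finset.prod_pos fun _ _ => modelDensity_pos θ hσ _

/-- The `α`-th moment of the likelihood ratio of an i.i.d. sample. -/
lemma lintegral_likelihoodRatio_rpow_le {n : ℕ} (PX : Measure (Vec d)) [IsProbabilityMeasure PX]
    (θ₀ : Vec d) {σ₀ : ℝ} (hσ₀ : 0 < σ₀) {p : Vec d × ℝ} (hσ : 0 < p.2) {α : ℝ}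
    (hα0 : 0 < α) (hα1 : α < 1) {Ω : Type*} [MeasurableSpace Ω] {μ : Measure Ω}
    {Z : Fin n → Ω → ℝ × Vec d} (hZ : iIndepFun Z μ) (hZm : ∀ i, Measurable (Z i))
    (hlaw : ∀ i, HasLaw (Z i) (modelLaw PX θ₀ σ₀) μ) :
    ∫⁻ ω, ENNReal.ofReal (likelihoodRatio θ₀ σ₀ (fun i => Z i ω) p ^ α) ∂μ
      ≤ ENNReal.ofReal (Real.exp (-(n * min α (1 - α) * modelHellinger PX θ₀ σ₀ p))) := by
  set g : ℝ × Vec d → ENNReal := fun z =>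
    ENNReal.ofReal ((modelDensity p.1 p.2 z / modelDensity θ₀ σ₀ z) ^ α) with hg
  have hgm : Measurable g := by
    have h1 := measurable_modelDensity p.1 p.2
    have h2 := measurable_modelDensity θ₀ σ₀
    fun_prop
  have e : ∀ ω, ENNReal.ofReal (likelihoodRatio θ₀ σ₀ (fun i => Z i ω) p ^ α)
      = ∏ i, g (Z i ω) := by
    intro ω
    rw [likelihoodRatio, ← Real.finsetProd_rpow _ _ fun i _ =>
      div_nonneg (modelDensity_nonneg _ _ _) (modelDensity_nonneg _ _ _),
      ENNReal.ofReal_prod_of_nonneg fun i _ => Real.rpow_nonneg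
        (div_nonneg (modelDensity_nonneg _ _ _) (modelDensity_nonneg _ _ _)) _]
  simp only [e]
  rw [lintegral_prod_eq_prod_lintegral_of_indepFun Finset.univ (fun i ω => g (Z i ω))
    (hZ.comp (fun _ => g) fun _ => hgm) fun i => hgm.comp (hZm i)]
  have h1 : ∀ i, ∫⁻ ω, g (Z i ω) ∂μ
      ≤ ENNReal.ofReal (Real.exp (-(min α (1 - α) * modelHellinger PX θ₀ σ₀ p))) := fun i => by
    rw [(hlaw i).lintegral_comp hgm.aemeasurable]
    exact lintegral_density_ratio_rpow_le PX θ₀ hσ₀ p.1 hσ hα0 hα1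
  refine (Finset.prod_le_prod' fun i _ => h1 i).trans_eq ?_
  rw [Finset.prod_const, Finset.card_univ, Fintype.card_fin, ← ENNReal.ofReal_pow
    (Real.exp_nonneg _), ← Real.exp_nat_mul]
  congr 2
  ring

end Model

/-! ### Normalised measures and posterior expectations -/

section Posterior

variable {T : Type*} [MeasurableSpace T]

lemma normalized_univ_le_one (μ : Measure T) : normalized μ Set.univ ≤ 1 := by
  rw [normalized, Measure.smul_apply, smul_eq_mul]
  exact ENNReal.inv_mul_le_one _

lemma normalized_smul (μ : Measure T) {c : ENNReal} (h0 : c ≠ 0) (ht : c ≠ ⊤) :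
    normalized (c • μ) = normalized μ := by
  rw [normalized, normalized, smul_smul, Measure.smul_apply, smul_eq_mul,
    ENNReal.mul_inv (.inl h0) (.inl ht), mul_assoc, mul_comm _ c, ← mul_assoc,
    ENNReal.inv_mul_cancel h0 ht, one_mul]

/-- Posterior expectations are controlled by exponential moments. -/
lemma lintegral_normalized_withDensity_le (π : Measure T) {r h : T → ℝ} (hr : Measurable r)
    (hr0 : ∀ x, 0 ≤ r x) (hh : Measurable h) (hh0 : ∀ x, 0 ≤ h x) {k t : ℝ} (hk : 0 < k)
    (hD : ∫⁻ x, ENNReal.ofReal (r x) ∂π ≠ 0)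
    (hG : ∫⁻ x, ENNReal.ofReal (r x * Real.exp (k * h x)) ∂π ≠ ⊤)
    (hGD : ∫⁻ x, ENNReal.ofReal (r x * Real.exp (k * h x)) ∂π
      ≤ ENNReal.ofReal (Real.exp t) * ∫⁻ x, ENNReal.ofReal (r x) ∂π) (ht : 0 ≤ t) :
    ∫⁻ x, ENNReal.ofReal (h x) ∂(normalized (π.withDensity fun x => ENNReal.ofReal (r x)))
      ≤ ENNReal.ofReal (t / k) := by
  set D := ∫⁻ x, ENNReal.ofReal (r x) ∂π with hDdef
  set G := ∫⁻ x, ENNReal.ofReal (r x * Real.exp (k * h x)) ∂π with hGdef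
  set ν := normalized (π.withDensity fun x => ENNReal.ofReal (r x)) with hν
  have hDt : D ≠ ⊤ := by
    refine ne_top_of_le_ne_top hG (lintegral_mono fun x => ENNReal.ofReal_le_ofReal ?_)
    exact le_mul_of_one_le_right (hr0 x) (Real.one_le_exp (mul_nonneg hk.le (hh0 x)))
  have hνe : ν = D⁻¹ • π.withDensity fun x => ENNReal.ofReal (r x) := by
    rw [hν, normalized, withDensity_apply _ .univ, Measure.restrict_univ]
  have hν1 : ν Set.univ = 1 := by
    rw [hνe, Measure.smul_apply, withDensity_apply _ .univ, Measure.restrict_univ, smul_eq_mul,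
      ENNReal.inv_mul_cancel hD hDt]
  have hexp : ∫⁻ x, ENNReal.ofReal (Real.exp (k * h x)) ∂ν ≤ ENNReal.ofReal (Real.exp t) := by
    rw [hνe, lintegral_smul_measure, lintegral_withDensity_eq_lintegral_mul _ hr.ennreal_ofReal
      (by fun_prop), smul_eq_mul]
    have : ∫⁻ x, ((fun x => ENNReal.ofReal (r x)) * fun x =>
        ENNReal.ofReal (Real.exp (k * h x))) x ∂π = G :=
      lintegral_congr fun x => (ENNReal.ofReal_mul (hr0 x)).symm
    rw [this]
    calc D⁻¹ * G ≤ D⁻¹ * (ENNReal.ofReal (Real.exp t) * D) := by gcongr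
      _ = ENNReal.ofReal (Real.exp t) := by
        rw [mul_comm _ D, ← mul_assoc, ENNReal.inv_mul_cancel hD hDt, one_mul]
  -- The tangent inequality y + 1 ≤ t + exp(y - t) at y = k h replaces Jensen. It is kept additive
  -- because the values are in `ENNReal`; after integration the exponential term is at most 1 and
  -- cancels the 1 on the left.
  have hpt : ∀ x, ENNReal.ofReal k * ENNReal.ofReal (h x) + 1
      ≤ ENNReal.ofReal t
        + ENNReal.ofReal (Real.exp (-t)) * ENNReal.ofReal (Real.exp (k * h x)) := by
    intro x
    rw [← ENNReal.ofReal_mul hk.le, ← ENNReal.ofReal_mul (Real.exp_nonneg _),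
      ← ENNReal.ofReal_one, ← ENNReal.ofReal_add (mul_nonneg hk.le (hh0 x)) zero_le_one,
      ← ENNReal.ofReal_add ht (by positivity), ← Real.exp_add]
    refine ENNReal.ofReal_le_ofReal ?_
    linarith [Real.add_one_le_exp (-t + k * h x)]
  have hint := lintegral_mono (μ := ν) hpt
  rw [lintegral_add_right _ measurable_const, lintegral_const_mul _ hh.ennreal_ofReal,
    lintegral_add_left measurable_const, lintegral_const_mul _ (by fun_prop), lintegral_const,
    lintegral_const, hν1, mul_one, mul_one] at hint
  have h2 : ENNReal.ofReal k * ∫⁻ x, ENNReal.ofReal (h x) ∂ν + 1 ≤ ENNReal.ofReal t + 1 := by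
    refine hint.trans ?_
    gcongr
    calc ENNReal.ofReal (Real.exp (-t)) * ∫⁻ x, ENNReal.ofReal (Real.exp (k * h x)) ∂ν
        ≤ ENNReal.ofReal (Real.exp (-t)) * ENNReal.ofReal (Real.exp t) := by gcongr
      _ = 1 := by rw [← ENNReal.ofReal_mul (Real.exp_nonneg _), ← Real.exp_add]; simp
  have h3 := (ENNReal.add_le_add_iff_right ENNReal.one_ne_top).1 h2
  rw [ENNReal.ofReal_div_of_pos hk, ENNReal.le_div_iff_mul_le (by simp [hk]) (by simp), mul_comm]
  exact h3

end Posterior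

/-! ### The prior on the variance -/

section InverseGamma

lemma measurable_inverseGamma_density (a b : ℝ) : Measurable fun v : ℝ =>
    ENNReal.ofReal (b ^ a / Real.Gamma a * v ^ (-a - 1) * Real.exp (-b / v)) := by
  fun_prop

/-- The substitution v ↦ 1/v turns the density into that of a Gamma law. An upper bound on the mass
is all that Fubini and the moment bound need. -/
lemma inverseGamma_univ_le_one {a b : ℝ} (ha : 0 < a) (hb : 0 < b) :
    inverseGamma a b Set.univ ≤ 1 := by
  have himg : (fun x : ℝ => x⁻¹) '' Set.Ioi 0 = Set.Ioi 0 := by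
    ext y
    constructor
    · rintro ⟨x, hx, rfl⟩
      exact Set.mem_Ioi.2 (inv_pos.2 (Set.mem_Ioi.1 hx))
    · exact fun hy => ⟨y⁻¹, Set.mem_Ioi.2 (inv_pos.2 (Set.mem_Ioi.1 hy)), inv_inv y⟩
  have h := lintegral_image_eq_lintegral_abs_deriv_mul (s := Set.Ioi (0 : ℝ))
    (f := fun x => x⁻¹) (f' := fun x => -(x ^ 2)⁻¹) measurableSet_Ioi
    (fun x hx => (hasDerivAt_inv (ne_of_gt hx)).hasDerivWithinAt)
    inv_injective.injOn (gammaPDF a b)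
  rw [himg] at h
  rw [inverseGamma, withDensity_apply _ .univ, Measure.restrict_univ]
  calc ∫⁻ v in Set.Ioi 0, ENNReal.ofReal (b ^ a / Real.Gamma a * v ^ (-a - 1)
        * Real.exp (-b / v))
      = ∫⁻ v in Set.Ioi 0, ENNReal.ofReal |-(v ^ 2)⁻¹| * gammaPDF a b v⁻¹ := by
        refine setLIntegral_congr_fun measurableSet_Ioi fun v hv => ?_
        have hv : 0 < v := hv
        rw [gammaPDF_of_nonneg (inv_pos.2 hv).le, ← ENNReal.ofReal_mul (abs_nonneg _), abs_neg,
          abs_of_nonneg (by positivity)]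
        congr 1
        have e : v ^ (-a - 1) = (v ^ 2)⁻¹ * v⁻¹ ^ (a - 1) := by
          rw [Real.inv_rpow hv.le, ← Real.rpow_neg hv.le, ← Real.rpow_natCast v 2,
            ← Real.rpow_neg hv.le, ← Real.rpow_add hv]
          congr 1
          push_cast
          ring
        rw [e, neg_div, div_eq_mul_inv b v]
        ring
    _ = ∫⁻ v in Set.Ioi 0, gammaPDF a b v := h.symm
    _ ≤ ∫⁻ v, gammaPDF a b v := setLIntegral_le_lintegral _ _
    _ = 1 := lintegral_gammaPDF_eq_one ha hb

/-- A lower bound on the inverse-Gamma mass of an interval `[u, u + δ]`. -/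
lemma inverseGamma_Icc_ge {a b u δ M : ℝ} (ha : 0 < a) (hb : 0 < b) (hu : 0 < u) (hδ : 0 ≤ δ)
    (hM : u + δ ≤ M) :
    ENNReal.ofReal (b ^ a / Real.Gamma a * M ^ (-a - 1) * Real.exp (-b / u) * δ)
      ≤ inverseGamma a b (Set.Icc u (u + δ)) := by
  have hΓ := Real.Gamma_pos_of_pos ha
  have hM0 : 0 < M := by linarith
  have hba : 0 < b ^ a := Real.rpow_pos_of_pos hb _
  have hMa : 0 < M ^ (-a - 1) := Real.rpow_pos_of_pos hM0 _
  rw [inverseGamma, withDensity_apply _ measurableSet_Icc, Measure.restrict_restrict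
    measurableSet_Icc, Set.inter_eq_left.2 (show Set.Icc u (u + δ) ⊆ Set.Ioi 0 from
      fun x hx => lt_of_lt_of_le hu hx.1)]
  have : ∫⁻ _ in Set.Icc u (u + δ),
      ENNReal.ofReal (b ^ a / Real.Gamma a * M ^ (-a - 1) * Real.exp (-b / u))
      ≤ ∫⁻ v in Set.Icc u (u + δ),
        ENNReal.ofReal (b ^ a / Real.Gamma a * v ^ (-a - 1) * Real.exp (-b / v)) := by
    refine setLIntegral_mono (measurable_inverseGamma_density a b) fun v hv => ?_
    have hv0 : 0 < v := lt_of_lt_of_le hu hv.1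
    have h1 : M ^ (-a - 1) ≤ v ^ (-a - 1) :=
      Real.rpow_le_rpow_of_nonpos hv0 (hv.2.trans hM) (by linarith)
    have h2 : -b / u ≤ -b / v := by
      rw [neg_div, neg_div, neg_le_neg_iff]
      exact div_le_div_of_nonneg_left hb.le hu hv.1
    gcongr
  refine le_trans (le_of_eq ?_) this
  rw [setLIntegral_const, Real.volume_Icc, ← ENNReal.ofReal_mul (by positivity)]
  congr 2
  ring

/-- The Gaussian density formulas need σ > 0; this discards the other values of σ. -/
lemma map_sqrt_inverseGamma_ae_pos (a b : ℝ) :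
    ∀ᵐ σ ∂(inverseGamma a b).map Real.sqrt, 0 < σ := by
  rw [ae_map_iff (by fun_prop) measurableSet_Ioi]
  have : ∀ᵐ v ∂volume.restrict (Set.Ioi (0 : ℝ)), 0 < v := ae_restrict_mem measurableSet_Ioi
  have h := (withDensity_absolutelyContinuous (volume.restrict (Set.Ioi (0 : ℝ)))
    fun v => ENNReal.ofReal (b ^ a / Real.Gamma a * v ^ (-a - 1) * Real.exp (-b / v))).ae_le this
  filter_upwards [h] with v hv using Real.sqrt_pos.2 hv

end InverseGamma

/-! ### The scaled Student distribution on the line -/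

section Student

open Filter Topology

/-- The unnormalised density `(τ² + x²)⁻²` of the scaled Student distribution. -/
def studentWeight (τ x : ℝ) : ℝ := ((τ ^ 2 + x ^ 2) ^ 2)⁻¹

/-- The normalising constant of the scaled Student distribution. -/
def studentConst (τ : ℝ) : ℝ := ∫ x, studentWeight τ x

/-- The scaled Student distribution. -/
def studentMeasure (τ : ℝ) : Measure ℝ :=
  volume.withDensity fun x => ENNReal.ofReal ((studentConst τ)⁻¹ * studentWeight τ x)

variable {τ : ℝ}

@[fun_prop]
lemma measurable_studentWeight (τ : ℝ) : Measurable (studentWeight τ) := by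
  unfold studentWeight
  fun_prop

lemma studentWeight_nonneg (τ x : ℝ) : 0 ≤ studentWeight τ x := by
  unfold studentWeight
  positivity

lemma studentWeight_pos (hτ : 0 < τ) (x : ℝ) : 0 < studentWeight τ x := by
  unfold studentWeight
  positivity

lemma studentWeight_neg (τ x : ℝ) : studentWeight τ (-x) = studentWeight τ x := by
  simp [studentWeight]

lemma integrable_inv_sq_add_sq (hτ : 0 < τ) : Integrable fun x : ℝ => (τ ^ 2 + x ^ 2)⁻¹ := by
  refine ((integrable_inv_one_add_sq.comp_div hτ.ne').const_mul (τ ^ 2)⁻¹).congr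
    (.of_forall fun x => ?_)
  simp only []
  rw [← mul_inv]
  congr 1
  field_simp

lemma integrable_studentWeight (hτ : 0 < τ) : Integrable (studentWeight τ) := by
  refine ((integrable_inv_sq_add_sq hτ).const_mul (τ ^ 2)⁻¹).mono'
    (measurable_studentWeight τ).aestronglyMeasurable (.of_forall fun x => ?_)
  rw [Real.norm_of_nonneg (studentWeight_nonneg _ _), studentWeight, ← mul_inv]
  refine inv_anti₀ (by positivity) ?_
  nlinarith [sq_nonneg x, sq_nonneg τ, mul_nonneg (sq_nonneg x) (sq_nonneg τ),
    mul_nonneg (sq_nonneg x) (sq_nonneg x)]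

lemma integrable_sq_mul_studentWeight (hτ : 0 < τ) :
    Integrable fun x => x ^ 2 * studentWeight τ x := by
  refine (integrable_inv_sq_add_sq hτ).mono' (by fun_prop) (.of_forall fun x => ?_)
  have h : 0 < τ ^ 2 + x ^ 2 := by positivity
  rw [Real.norm_of_nonneg (mul_nonneg (sq_nonneg x) (studentWeight_nonneg _ _)), studentWeight,
    sq (τ ^ 2 + x ^ 2), mul_inv, ← mul_assoc]
  refine mul_le_of_le_one_left (by positivity) ?_
  rw [← div_eq_mul_inv, div_le_one h]
  nlinarith [sq_nonneg τ]

/-- The function x / (τ² + x²) vanishes at ±∞ and has derivative (τ² - x²) / (τ² + x²)². Hence the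
second moment is found without evaluating the normalising constant. -/
lemma integral_sq_mul_studentWeight (hτ : 0 < τ) :
    ∫ x, x ^ 2 * studentWeight τ x = τ ^ 2 * studentConst τ := by
  have hpos : ∀ x : ℝ, 0 < τ ^ 2 + x ^ 2 := fun x => by positivity
  have hder : ∀ x : ℝ, HasDerivAt (fun x => x / (τ ^ 2 + x ^ 2))
      (τ ^ 2 * studentWeight τ x - x ^ 2 * studentWeight τ x) x := by
    intro x
    have h := (hasDerivAt_id x).div (((hasDerivAt_id x).pow 2).const_add (τ ^ 2)) (hpos x).ne'
    refine h.congr_deriv ?_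
    have := (hpos x).ne'
    simp only [studentWeight, id, Nat.cast_ofNat, Pi.pow_apply]
    field_simp
    ring
  have htop : Tendsto (fun x : ℝ => x / (τ ^ 2 + x ^ 2)) atTop (𝓝 0) := by
    refine squeeze_zero' ?_ ?_ tendsto_inv_atTop_zero
    · filter_upwards [eventually_ge_atTop 0] with x hx using div_nonneg hx (hpos x).le
    · filter_upwards [eventually_gt_atTop 0] with x hx
      rw [div_le_iff₀ (hpos x), inv_mul_eq_div, le_div_iff₀ hx]
      nlinarith [sq_nonneg τ]
  have hbot : Tendsto (fun x : ℝ => x / (τ ^ 2 + x ^ 2)) atBot (𝓝 0) := by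
    have := (htop.comp tendsto_neg_atBot_atTop).neg
    simpa [Function.comp_def, neg_div] using this
  have hw := (integrable_studentWeight hτ).const_mul (τ ^ 2)
  have hx := integrable_sq_mul_studentWeight hτ
  have := integral_of_hasDerivAt_of_tendsto hder (hw.sub hx) hbot htop
  rw [integral_sub hw hx, integral_const_mul] at this
  rw [studentConst]
  linarith

lemma studentConst_pos (hτ : 0 < τ) : 0 < studentConst τ := by
  rw [studentConst, integral_pos_iff_support_of_nonneg (studentWeight_nonneg τ)
    (integrable_studentWeight hτ)]
  have : Function.support (studentWeight τ) = Set.univ :=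
    Set.eq_univ_of_forall fun x => (studentWeight_pos hτ x).ne'
  simp [this]

/-- Lets the normaliser at scale ητ stand in for the one at scale τ when the prior is bounded below.
-/
lemma studentConst_anti {τ' : ℝ} (hτ' : 0 < τ') (h : τ' ≤ τ) :
    studentConst τ ≤ studentConst τ' := by
  refine integral_mono (integrable_studentWeight (hτ'.trans_le h))
    (integrable_studentWeight hτ') fun x => ?_
  simp only [studentWeight]
  gcongr

lemma isProbabilityMeasure_studentMeasure (hτ : 0 < τ) :
    IsProbabilityMeasure (studentMeasure τ) := by
  constructor
  have hc := studentConst_pos hτ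
  rw [studentMeasure, withDensity_apply _ .univ, Measure.restrict_univ,
    ← ofReal_integral_eq_lintegral_ofReal ((integrable_studentWeight hτ).const_mul _)
    (.of_forall fun x => mul_nonneg (inv_nonneg.2 hc.le) (studentWeight_nonneg _ _)),
    integral_const_mul, ← studentConst, inv_mul_cancel₀ hc.ne', ENNReal.ofReal_one]

lemma integral_studentMeasure (hτ : 0 < τ) (f : ℝ → ℝ) :
    ∫ x, f x ∂studentMeasure τ = (studentConst τ)⁻¹ * ∫ x, f x * studentWeight τ x := by
  have hc := studentConst_pos hτ
  have hn : ∀ x, 0 ≤ (studentConst τ)⁻¹ * studentWeight τ x := fun x =>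
    mul_nonneg (inv_nonneg.2 hc.le) (studentWeight_nonneg _ _)
  rw [studentMeasure, integral_withDensity_eq_integral_toReal_smul (by fun_prop)
    (.of_forall fun x => ENNReal.ofReal_lt_top), ← integral_const_mul]
  refine integral_congr_ae (.of_forall fun x => ?_)
  simp only [ENNReal.toReal_ofReal (hn x), smul_eq_mul]
  ring

lemma memLp_id_studentMeasure (hτ : 0 < τ) : MemLp (fun x : ℝ => x) 2 (studentMeasure τ) := by
  have hc := studentConst_pos hτ
  have hn : ∀ x, 0 ≤ (studentConst τ)⁻¹ * studentWeight τ x := fun x =>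
    mul_nonneg (inv_nonneg.2 hc.le) (studentWeight_nonneg _ _)
  rw [memLp_two_iff_integrable_sq measurable_id'.aestronglyMeasurable, studentMeasure,
    integrable_withDensity_iff_integrable_smul₀' (by fun_prop)
    (.of_forall fun x => ENNReal.ofReal_lt_top)]
  refine ((integrable_sq_mul_studentWeight hτ).const_mul (studentConst τ)⁻¹).congr
    (.of_forall fun x => ?_)
  simp only [ENNReal.toReal_ofReal (hn x), smul_eq_mul]
  ring

lemma integral_sq_studentMeasure (hτ : 0 < τ) : ∫ x, x ^ 2 ∂studentMeasure τ = τ ^ 2 := by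
  have hc := studentConst_pos hτ
  rw [integral_studentMeasure hτ, integral_sq_mul_studentWeight hτ]
  field_simp

lemma integral_id_studentMeasure (hτ : 0 < τ) : ∫ x, x ∂studentMeasure τ = 0 := by
  rw [integral_studentMeasure hτ]
  have h := integral_neg_eq_self (fun x => x * studentWeight τ x) (volume : Measure ℝ)
  simp only [studentWeight_neg, neg_mul, integral_neg] at h
  have : ∫ x, x * studentWeight τ x = 0 := by linarith
  rw [this, mul_zero]

lemma variance_studentMeasure (hτ : 0 < τ) :
    variance (fun x : ℝ => x) (studentMeasure τ) = τ ^ 2 := by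
  have := isProbabilityMeasure_studentMeasure hτ
  rw [variance_of_integral_eq_zero measurable_id'.aemeasurable (integral_id_studentMeasure hτ)]
  exact integral_sq_studentMeasure hτ

/-- Integrate 2τ|x| ≤ τ² + x². -/
lemma integral_abs_studentMeasure_le (hτ : 0 < τ) : ∫ x, |x| ∂studentMeasure τ ≤ τ := by
  have := isProbabilityMeasure_studentMeasure hτ
  have hm := memLp_id_studentMeasure hτ
  have h1 : Integrable (fun x : ℝ => |x|) (studentMeasure τ) :=
    (hm.integrable (by norm_num)).abs
  have h2 : Integrable (fun x : ℝ => x ^ 2) (studentMeasure τ) := hm.integrable_sq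
  have h3 : ∫ x, 2 * τ * |x| ∂studentMeasure τ ≤ ∫ x, (τ ^ 2 + x ^ 2) ∂studentMeasure τ :=
    integral_mono (h1.const_mul _) ((integrable_const _).add h2) fun x => by
      simp only []
      nlinarith [sq_nonneg (τ - |x|), sq_abs x]
  rw [integral_const_mul, integral_add (integrable_const _) h2, integral_sq_studentMeasure hτ]
    at h3
  simp only [integral_const, probReal_univ, smul_eq_mul, one_mul] at h3
  nlinarith

end Student

/-! ### Products of scaled Student distributions -/

section StudentProduct

/-- It suffices to test on boxes, where the indicator is absorbed coordinatewise into the factors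
and the integral of the product splits. -/
lemma pi_withDensity_ofReal {ι : Type*} [Fintype ι] {f : ℝ → ℝ}
    (hf0 : ∀ x, 0 ≤ f x) (hfi : Integrable f) :
    Measure.pi (fun _ : ι => (volume : Measure ℝ).withDensity fun x => ENNReal.ofReal (f x))
      = (volume : Measure (ι → ℝ)).withDensity fun x => ENNReal.ofReal (∏ i, f (x i)) := by
  have := isFiniteMeasure_withDensity_ofReal hfi.2
  refine Measure.pi_eq fun s hs => ?_
  have hp : MeasurableSet (Set.univ.pi s) := MeasurableSet.univ_pi hs
  have e : ∀ x : ι → ℝ, (Set.univ.pi s).indicator (fun x => ENNReal.ofReal (∏ i, f (x i))) x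
      = ENNReal.ofReal (∏ i, (s i).indicator f (x i)) := by
    intro x
    by_cases hx : x ∈ Set.univ.pi s
    · rw [Set.indicator_of_mem hx]
      congr 1
      exact Finset.prod_congr rfl fun i _ => (Set.indicator_of_mem (hx i trivial) f).symm
    · rw [Set.indicator_of_notMem hx]
      obtain ⟨i, hi⟩ : ∃ i, x i ∉ s i := by simpa [Set.mem_univ_pi] using hx
      rw [Finset.prod_eq_zero (Finset.mem_univ i) (Set.indicator_of_notMem hi f)]
      simp
  have hi0 : ∀ i x, 0 ≤ (s i).indicator f x := fun i x =>
    Set.indicator_nonneg (fun x _ => hf0 x) x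
  have hii : ∀ i, Integrable ((s i).indicator f) := fun i => hfi.indicator (hs i)
  rw [withDensity_apply _ hp, ← lintegral_indicator hp]
  simp only [e]
  rw [volume_pi, ← ofReal_integral_eq_lintegral_ofReal (Integrable.fintype_prod hii)
    (.of_forall fun x => Finset.prod_nonneg fun i _ => hi0 i _), integral_fintype_prod_eq_prod,
    ENNReal.ofReal_prod_of_nonneg fun i _ => integral_nonneg (hi0 i)]
  refine Finset.prod_congr rfl fun i _ => ?_
  rw [withDensity_apply _ (hs i), ofReal_integral_eq_lintegral_ofReal (hii i)
    (.of_forall (hi0 i)), ← lintegral_indicator (hs i)]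
  refine lintegral_congr fun x => ?_
  by_cases hx : x ∈ s i <;> simp [hx]

variable {d : ℕ} {τ : ℝ}

/-- The product of `d` scaled Student distributions. -/
def studentVec (d : ℕ) (τ : ℝ) : Measure (Vec d) :=
  (Measure.pi fun _ : Fin d => studentMeasure τ).map (WithLp.toLp 2)

lemma isProbabilityMeasure_studentVec (hτ : 0 < τ) : IsProbabilityMeasure (studentVec d τ) := by
  have := isProbabilityMeasure_studentMeasure hτ
  exact Measure.isProbabilityMeasure_map (by fun_prop)

lemma studentVec_eq_withDensity (hτ : 0 < τ) :
    studentVec d τ = volume.withDensity fun θ : Vec d =>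
      ENNReal.ofReal ((studentConst τ)⁻¹ ^ d * ∏ i, studentWeight τ (θ i)) := by
  have hc := studentConst_pos hτ
  have h := pi_withDensity_ofReal (ι := Fin d)
    (f := fun x => (studentConst τ)⁻¹ * studentWeight τ x)
    (fun x => mul_nonneg (inv_nonneg.2 hc.le) (studentWeight_nonneg _ _))
    ((integrable_studentWeight hτ).const_mul _)
  have hm : Measurable fun θ : Vec d =>
      ENNReal.ofReal ((studentConst τ)⁻¹ ^ d * ∏ i, studentWeight τ (θ i)) := by fun_prop
  rw [studentVec]
  simp only [studentMeasure]
  rw [h]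
  refine Measure.ext_of_lintegral _ fun F hF => ?_
  have hmp := PiLp.volume_preserving_toLp (Fin d)
  rw [lintegral_map hF (by fun_prop), lintegral_withDensity_eq_lintegral_mul _ (by fun_prop)
    (by fun_prop), lintegral_withDensity_eq_lintegral_mul _ hm hF,
    ← hmp.lintegral_comp (hm.mul hF)]
  refine lintegral_congr fun x => ?_
  simp [Finset.prod_mul_distrib]

/-- Second moments of linear forms. -/
lemma lintegral_inner_sq_studentVec (hτ : 0 < τ) (x : Vec d) :
    ∫⁻ δ, ENNReal.ofReal ((inner ℝ x δ) ^ 2) ∂studentVec d τ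
      = ENNReal.ofReal (τ ^ 2 * ‖x‖ ^ 2) := by
  have := isProbabilityMeasure_studentMeasure hτ
  have hm : ∀ i, MemLp (fun y : ℝ => x i * y) 2 (studentMeasure τ) := fun i =>
    (memLp_id_studentMeasure hτ).const_mul (x i)
  have hv := variance_sum_pi (μ := fun _ : Fin d => studentMeasure τ) hm
  have hL : MemLp (∑ i, fun ω : Fin d → ℝ => x i * ω i) 2
      (Measure.pi fun _ : Fin d => studentMeasure τ) :=
    memLp_finsetSum' _ fun i _ => (hm i).comp_measurePreserving (measurePreserving_eval _ i)
  have h0 : ∫ ω, (∑ i, fun ω : Fin d → ℝ => x i * ω i) ω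
      ∂(Measure.pi fun _ : Fin d => studentMeasure τ) = 0 := by
    simp only [Finset.sum_apply]
    have hi : ∀ i, Integrable (fun ω : Fin d → ℝ => x i * ω i)
        (Measure.pi fun _ : Fin d => studentMeasure τ) := fun i =>
      ((hm i).comp_measurePreserving (measurePreserving_eval _ i)).integrable (by norm_num)
    rw [integral_finsetSum _ fun i _ => hi i]
    refine Finset.sum_eq_zero fun i _ => ?_
    rw [integral_const_mul]
    have := integral_comp_eval (μ := fun _ : Fin d => studentMeasure τ) (i := i)
      (f := fun y : ℝ => y) (measurable_id'.aestronglyMeasurable)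
    rw [this, integral_id_studentMeasure hτ, mul_zero]
  rw [variance_of_integral_eq_zero hL.aestronglyMeasurable.aemeasurable h0] at hv
  rw [studentVec, lintegral_map (by fun_prop) (by fun_prop)]
  have e : ∀ ω : Fin d → ℝ, (inner ℝ x (WithLp.toLp 2 ω) : ℝ) ^ 2
      = (∑ i, fun ω : Fin d → ℝ => x i * ω i) ω ^ 2 := by
    intro ω
    simp [PiLp.inner_apply, mul_comm]
  simp only [e]
  rw [← ofReal_integral_eq_lintegral_ofReal hL.integrable_sq (.of_forall fun ω => sq_nonneg _),
    hv]
  congr 1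
  rw [EuclideanSpace.norm_sq_eq, Finset.mul_sum]
  refine Finset.sum_congr rfl fun i _ => ?_
  rw [variance_const_mul, variance_studentMeasure hτ]
  simp [mul_comm]

@[fun_prop]
lemma measurable_l1Norm : Measurable (l1Norm : Vec d → ℝ) := by
  unfold l1Norm
  fun_prop

lemma l1Norm_nonneg (θ : Vec d) : 0 ≤ l1Norm θ := Finset.sum_nonneg fun _ _ => abs_nonneg _

lemma lintegral_l1Norm_studentVec_le (hτ : 0 < τ) :
    ∫⁻ δ, ENNReal.ofReal (l1Norm δ) ∂studentVec d τ ≤ ENNReal.ofReal (d * τ) := by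
  have := isProbabilityMeasure_studentMeasure hτ
  rw [studentVec, lintegral_map (by fun_prop) (by fun_prop)]
  have hi : ∀ i : Fin d, Integrable (fun ω : Fin d → ℝ => |ω i|)
      (Measure.pi fun _ : Fin d => studentMeasure τ) := fun i =>
    (((memLp_id_studentMeasure hτ).comp_measurePreserving
      (measurePreserving_eval (fun _ : Fin d => studentMeasure τ) i)).integrable
      (by norm_num)).abs
  simp only [l1Norm]
  rw [← ofReal_integral_eq_lintegral_ofReal (integrable_finsetSum _ fun i _ => hi i)
    (.of_forall fun ω => Finset.sum_nonneg fun _ _ => abs_nonneg _),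
    integral_finsetSum _ fun i _ => hi i]
  refine ENNReal.ofReal_le_ofReal ?_
  calc ∑ i : Fin d, ∫ ω : Fin d → ℝ, |ω i| ∂(Measure.pi fun _ : Fin d => studentMeasure τ)
      ≤ ∑ _i : Fin d, τ := Finset.sum_le_sum fun i _ => by
        have := integral_comp_eval (μ := fun _ : Fin d => studentMeasure τ) (i := i)
          (f := fun y : ℝ => |y|) (Measurable.aestronglyMeasurable (by fun_prop))
        rw [this]
        exact integral_abs_studentMeasure_le hτ
    _ = d * τ := by simp

/-- Markov's inequality for the ℓ₁ norm. The radius parameter is separate from the scale because the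
law is later shrunk to scale ητ while the ball keeps radius 2dτ. -/
lemma studentVec_l1Ball_ge (hτ : 0 < τ) {r : ℝ} (hd : 0 < d) (hr : τ ≤ r) :
    2⁻¹ ≤ studentVec d τ {δ | l1Norm δ ≤ 2 * d * r} := by
  have := isProbabilityMeasure_studentVec (d := d) hτ
  have hd' : (0 : ℝ) < d := by exact_mod_cast hd
  have hr0 : 0 < r := hτ.trans_le hr
  have hms : MeasurableSet {δ : Vec d | l1Norm δ ≤ 2 * d * r} :=
    measurableSet_le (by fun_prop) (by fun_prop)
  have hM := mul_meas_ge_le_lintegral₀ (μ := studentVec d τ)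
    (f := fun δ : Vec d => ENNReal.ofReal (l1Norm δ)) (by fun_prop)
    (ENNReal.ofReal (2 * d * r))
  have hsub : {δ : Vec d | l1Norm δ ≤ 2 * d * r}ᶜ
      ⊆ {δ : Vec d | ENNReal.ofReal (2 * d * r) ≤ ENNReal.ofReal (l1Norm δ)} := by
    intro δ hδ
    simp only [Set.mem_compl_iff, Set.mem_ofPred_eq, not_le] at hδ ⊢
    exact ENNReal.ofReal_le_ofReal hδ.le
  have hc : studentVec d τ {δ : Vec d | l1Norm δ ≤ 2 * d * r}ᶜ ≤ 2⁻¹ := by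
    refine (measure_mono hsub).trans ?_
    have hpos : 0 < 2 * d * r := by positivity
    have h1 : ENNReal.ofReal (d * τ) ≤ ENNReal.ofReal (2 * d * r) * 2⁻¹ := by
      rw [show (2⁻¹ : ENNReal) = ENNReal.ofReal 2⁻¹ by
        rw [ENNReal.ofReal_inv_of_pos two_pos, ENNReal.ofReal_ofNat],
        ← ENNReal.ofReal_mul hpos.le]
      refine ENNReal.ofReal_le_ofReal ?_
      nlinarith
    have h2 := (hM.trans (lintegral_l1Norm_studentVec_le hτ)).trans h1
    exact (ENNReal.mul_le_mul_iff_right (ENNReal.ofReal_pos.2 hpos).ne' ENNReal.ofReal_ne_top).1 h2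
  have h1 := prob_add_prob_compl (μ := studentVec d τ) hms
  by_contra! hlt
  have := ENNReal.add_lt_add_of_lt_of_le (ne_top_of_le_ne_top (by simp) hc) hlt hc
  rw [h1, ENNReal.inv_two_add_inv_two] at this
  exact lt_irrefl _ this

lemma lintegral_neg_studentVec (hτ : 0 < τ) (F : Vec d → ENNReal) (hF : Measurable F) :
    ∫⁻ δ, F (-δ) ∂studentVec d τ = ∫⁻ δ, F δ ∂studentVec d τ := by
  have hm : Measurable fun θ : Vec d =>
      ENNReal.ofReal ((studentConst τ)⁻¹ ^ d * ∏ i, studentWeight τ (θ i)) := by fun_prop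
  rw [studentVec_eq_withDensity hτ, lintegral_withDensity_eq_lintegral_mul _ hm (by fun_prop),
    lintegral_withDensity_eq_lintegral_mul _ hm hF,
    ← (Measure.measurePreserving_neg (volume : Measure (Vec d))).lintegral_comp (hm.mul hF)]
  refine lintegral_congr fun x => ?_
  simp [studentWeight_neg]

end StudentProduct

/-! ### Lower bound on the evidence -/

section Evidence

variable {d : ℕ} {τ η : ℝ}

/-- With u = |t|/τ, 2tx ≤ u(τ² + x²) gives τ² + (t + x)² ≤ (1 + u)²(τ² + x²), while shrinking the
scale costs a factor η² in the base. Translation is thus paid for only logarithmically in |t|/τ in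
the exponent, and is free at t = 0: this is where heavy tails exploit sparsity. -/
lemma studentWeight_add_ge (hτ : 0 < τ) (hη : 0 < η) (hη1 : η ≤ 1) (t x : ℝ) :
    η ^ 4 * ((1 + |t| / τ) ^ 4)⁻¹ * studentWeight (η * τ) x ≤ studentWeight τ (t + x) := by
  obtain ⟨u, hu⟩ : ∃ u, u = |t| / τ := ⟨_, rfl⟩
  have hu0 : 0 ≤ u := by rw [hu]; positivity
  have htu : |t| = u * τ := by rw [hu]; field_simp
  have hη2 : η ^ 2 ≤ 1 := by nlinarith
  have ht2 : t ^ 2 = u ^ 2 * τ ^ 2 := by rw [← sq_abs, htu]; ring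
  have htx : 2 * (t * x) ≤ u * (τ ^ 2 + x ^ 2) := by
    have h1 : t * x ≤ |t| * |x| := (le_abs_self _).trans (abs_mul t x).le
    rw [htu] at h1
    have h2 : 2 * (τ * |x|) ≤ τ ^ 2 + x ^ 2 := by nlinarith [sq_nonneg (τ - |x|), sq_abs x]
    nlinarith
  have hA : τ ^ 2 + (t + x) ^ 2 ≤ (1 + u) ^ 2 * (τ ^ 2 + x ^ 2) := by
    nlinarith [mul_nonneg hu0 (sq_nonneg τ), mul_nonneg hu0 (sq_nonneg x),
      mul_nonneg (sq_nonneg u) (sq_nonneg x)]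
  have hB : η ^ 2 * (τ ^ 2 + x ^ 2) ≤ (η * τ) ^ 2 + x ^ 2 := by
    nlinarith [mul_nonneg (sub_nonneg.2 hη2) (sq_nonneg x)]
  have hAB : η ^ 2 * (τ ^ 2 + (t + x) ^ 2) ≤ (1 + u) ^ 2 * ((η * τ) ^ 2 + x ^ 2) :=
    calc η ^ 2 * (τ ^ 2 + (t + x) ^ 2) ≤ η ^ 2 * ((1 + u) ^ 2 * (τ ^ 2 + x ^ 2)) := by gcongr
      _ = (1 + u) ^ 2 * (η ^ 2 * (τ ^ 2 + x ^ 2)) := by ring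
      _ ≤ _ := by gcongr
  have hsq := pow_le_pow_left₀ (by positivity) hAB 2
  have hA0 : 0 < τ ^ 2 + (t + x) ^ 2 := by positivity
  have hB0 : 0 < (η * τ) ^ 2 + x ^ 2 := by positivity
  have hu1 : 0 < 1 + u := by positivity
  rw [← hu, studentWeight, studentWeight, mul_assoc, ← mul_inv, ← div_eq_mul_inv,
    ← one_div, div_le_div_iff₀ (by positivity) (by positivity)]
  calc η ^ 4 * (τ ^ 2 + (t + x) ^ 2) ^ 2 = (η ^ 2 * (τ ^ 2 + (t + x) ^ 2)) ^ 2 := by ring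
    _ ≤ _ := hsq
    _ = _ := by ring

instance isFiniteMeasure_studentPrior (d : ℕ) (τ C₁ : ℝ) :
    IsFiniteMeasure (studentPrior d τ C₁) :=
  ⟨(normalized_univ_le_one _).trans_lt ENNReal.one_lt_top⟩

lemma lintegral_prod_studentWeight (hτ : 0 < τ) :
    ∫⁻ θ : Vec d, ENNReal.ofReal (∏ i, studentWeight τ (θ i))
      = ENNReal.ofReal (studentConst τ ^ d) := by
  have hc := studentConst_pos hτ
  have := isProbabilityMeasure_studentVec (d := d) hτ
  have h := measure_univ (μ := studentVec d τ)
  rw [studentVec_eq_withDensity hτ, withDensity_apply _ .univ, Measure.restrict_univ] at h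
  simp only [ENNReal.ofReal_mul (pow_nonneg (inv_nonneg.2 hc.le) d)] at h
  rw [lintegral_const_mul _ (by fun_prop)] at h
  have e : ENNReal.ofReal (studentConst τ ^ d) * ENNReal.ofReal ((studentConst τ)⁻¹ ^ d) = 1 := by
    rw [← ENNReal.ofReal_mul (by positivity), ← mul_pow, mul_inv_cancel₀ hc.ne', one_pow,
      ENNReal.ofReal_one]
  rw [← one_mul (∫⁻ θ : Vec d, _), ← e, mul_assoc, h, mul_one]

/-- Translation invariance of Lebesgue measure reduces the comparison to one between densities.
Constants on both sides avoid division in `ENNReal`. -/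
lemma setLIntegral_shift_le {A B : Set (Vec d)} (hA : MeasurableSet A) (hB : MeasurableSet B)
    {w w' F : Vec d → ENNReal} (hw : Measurable w) (hw' : Measurable w') (hF : Measurable F)
    (θ₀ : Vec d) (κ c : ENNReal) (hAB : ∀ δ ∈ B, θ₀ + δ ∈ A)
    (h : ∀ δ, κ * w' δ ≤ c * w (θ₀ + δ)) :
    κ * ∫⁻ δ in B, F (θ₀ + δ) ∂(volume.withDensity w')
      ≤ c * ∫⁻ θ, F θ ∂((volume.restrict A).withDensity w) := by
  have hF' : Measurable fun δ => F (θ₀ + δ) := by fun_prop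
  rw [restrict_withDensity hB, lintegral_withDensity_eq_lintegral_mul _ hw' hF',
    lintegral_withDensity_eq_lintegral_mul _ hw hF, ← lintegral_indicator hA,
    ← lintegral_indicator hB, ← lintegral_add_left_eq_self (A.indicator (w * F)) θ₀,
    ← lintegral_const_mul _ ((hw'.mul hF').indicator hB),
    ← lintegral_const_mul (f := fun x => A.indicator (w * F) (θ₀ + x)) _
      (((hw.mul hF).indicator hA).comp (measurable_const_add θ₀))]
  refine lintegral_mono fun δ => ?_
  by_cases hδ : δ ∈ B
  · rw [Set.indicator_of_mem hδ, Set.indicator_of_mem (hAB δ hδ), Pi.mul_apply, Pi.mul_apply,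
      ← mul_assoc, ← mul_assoc]
    exact mul_le_mul_left (h δ) _
  · simp [Set.indicator_of_notMem hδ]

/-- The Student prior dominates a multiple of a recentred, rescaled and truncated product of
Student distributions. -/
lemma lintegral_studentPrior_ge (hτ : 0 < τ) (hη : 0 < η) (hη1 : η ≤ 1) {C₁ : ℝ} {θ₀ : Vec d}
    (hθ₀ : l1Norm θ₀ ≤ C₁ - 2 * d * τ) {F : Vec d → ENNReal} (hF : Measurable F) :
    ENNReal.ofReal (∏ i, (η ^ 4 * ((1 + |θ₀ i| / τ) ^ 4)⁻¹))
        * ∫⁻ δ in {δ | l1Norm δ ≤ 2 * d * τ}, F (θ₀ + δ) ∂studentVec d (η * τ)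
      ≤ ∫⁻ θ, F θ ∂studentPrior d τ C₁ := by
  have hτ' : 0 < η * τ := mul_pos hη hτ
  have hle : η * τ ≤ τ := mul_le_of_le_one_left hτ.le hη1
  have hc := studentConst_pos hτ
  have hc' := studentConst_pos hτ'
  have hcc := studentConst_anti hτ' hle
  have hball : MeasurableSet {θ : Vec d | l1Norm θ ≤ C₁} :=
    measurableSet_le (by fun_prop) (by fun_prop)
  have hB : MeasurableSet {δ : Vec d | l1Norm δ ≤ 2 * d * τ} :=
    measurableSet_le (by fun_prop) (by fun_prop)
  have hw : Measurable fun θ : Vec d => ENNReal.ofReal (∏ i, studentWeight τ (θ i)) := by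
    fun_prop
  have hw' : Measurable fun θ : Vec d => ENNReal.ofReal
      ((studentConst (η * τ))⁻¹ ^ d * ∏ i, studentWeight (η * τ) (θ i)) := by fun_prop
  have hprior : studentPrior d τ C₁ = normalized ((volume.restrict
      {θ : Vec d | l1Norm θ ≤ C₁}).withDensity fun θ =>
        ENNReal.ofReal (∏ i, studentWeight τ (θ i))) := rfl
  -- Truncation to the ball only decreases the prior's normaliser, so its inverse may be replaced by
  -- that of the full integral, then by the one at the smaller scale.
  have hZ : ENNReal.ofReal ((studentConst (η * τ))⁻¹ ^ d)
      ≤ (∫⁻ θ in {θ : Vec d | l1Norm θ ≤ C₁},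
        ENNReal.ofReal (∏ i, studentWeight τ (θ i)))⁻¹ := by
    rw [← inv_inv (ENNReal.ofReal _)]
    refine ENNReal.inv_le_inv.2 ?_
    refine (setLIntegral_le_lintegral _ _).trans ?_
    rw [lintegral_prod_studentWeight hτ, ← ENNReal.ofReal_inv_of_pos (by positivity), inv_pow,
      inv_inv]
    exact ENNReal.ofReal_le_ofReal (pow_le_pow_left₀ hc.le hcc d)
  have hκ : 0 ≤ ∏ i, (η ^ 4 * ((1 + |θ₀ i| / τ) ^ 4)⁻¹) :=
    Finset.prod_nonneg fun i _ => by positivity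
  rw [hprior, normalized, lintegral_smul_measure, withDensity_apply _ .univ,
    Measure.restrict_univ, smul_eq_mul, studentVec_eq_withDensity hτ']
  refine le_trans (setLIntegral_shift_le hball hB hw hw' hF θ₀ _
    (ENNReal.ofReal ((studentConst (η * τ))⁻¹ ^ d)) (fun δ hδ => ?_) fun δ => ?_)
    (mul_le_mul_left hZ _)
  · have h1 : l1Norm (θ₀ + δ) ≤ l1Norm θ₀ + l1Norm δ := by
      rw [l1Norm, l1Norm, l1Norm, ← Finset.sum_add_distrib]
      exact Finset.sum_le_sum fun i _ => abs_add_le _ _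
    have h2 : l1Norm δ ≤ 2 * d * τ := hδ
    exact show l1Norm (θ₀ + δ) ≤ C₁ by linarith
  · rw [← ENNReal.ofReal_mul hκ, ← ENNReal.ofReal_mul (by positivity)]
    refine ENNReal.ofReal_le_ofReal ?_
    rw [mul_left_comm, ← Finset.prod_mul_distrib]
    refine mul_le_mul_of_nonneg_left ?_ (by positivity)
    refine Finset.prod_le_prod (fun i _ => ?_) fun i _ => studentWeight_add_ge hτ hη hη1 _ _
    have := studentWeight_nonneg (η * τ) (δ i)
    positivity

/-- Symmetrisation and the tangent inequality for the exponential. -/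
lemma setLIntegral_exp_inner_sub_ge (hτ : 0 < τ) {r : ℝ} (hd : 0 < d) (hr : τ ≤ r) (v : Vec d)
    {q : Vec d → ℝ} (hq : Measurable q) (hq0 : ∀ δ, 0 ≤ q δ) (hqe : ∀ δ, q (-δ) = q δ)
    {M : ℝ} (hM : 0 ≤ M)
    (hqM : ∫⁻ δ, ENNReal.ofReal (q δ) ∂studentVec d τ ≤ ENNReal.ofReal M) :
    ENNReal.ofReal (Real.exp (-(2 * M)) / 2)
      ≤ ∫⁻ δ in {δ | l1Norm δ ≤ 2 * d * r},
        ENNReal.ofReal (Real.exp (inner ℝ v δ - q δ)) ∂studentVec d τ := by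
  have hprob := isProbabilityMeasure_studentVec (d := d) hτ
  set B := {δ : Vec d | l1Norm δ ≤ 2 * d * r} with hBdef
  set ρ := studentVec d τ with hρ
  have hB : MeasurableSet B := measurableSet_le (by fun_prop) (by fun_prop)
  have hBn : ∀ δ, -δ ∈ B ↔ δ ∈ B := by
    intro δ
    simp [hBdef, l1Norm]
  set f : Vec d → ENNReal := fun δ => ENNReal.ofReal (Real.exp (inner ℝ v δ - q δ)) with hf
  have hfm : Measurable f := by fun_prop
  have hneg : ∫⁻ δ in B, f (-δ) ∂ρ = ∫⁻ δ in B, f δ ∂ρ := by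
    rw [← lintegral_indicator hB, ← lintegral_indicator hB,
      ← lintegral_neg_studentVec hτ _ (hfm.indicator hB)]
    refine lintegral_congr fun δ => ?_
    by_cases h : δ ∈ B
    · rw [Set.indicator_of_mem h, Set.indicator_of_mem ((hBn δ).2 h)]
    · rw [Set.indicator_of_notMem h, Set.indicator_of_notMem (mt (hBn δ).1 h)]
  -- Averaging over δ and -δ replaces the exponential of the linear form by a hyperbolic cosine,
  -- which is at least 1. Nothing about `v` is needed.
  have hsym : ∫⁻ δ in B, ENNReal.ofReal (Real.exp (-q δ)) ∂ρ ≤ ∫⁻ δ in B, f δ ∂ρ := by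
    have h2 : 2 * ∫⁻ δ in B, ENNReal.ofReal (Real.exp (-q δ)) ∂ρ ≤ 2 * ∫⁻ δ in B, f δ ∂ρ := by
      rw [two_mul (∫⁻ δ in B, f δ ∂ρ)]
      nth_rw 2 [← hneg]
      rw [← lintegral_add_left hfm, ← lintegral_const_mul _ (by fun_prop)]
      refine lintegral_mono fun δ => ?_
      simp only [hf, inner_neg_right, hqe]
      rw [two_mul, ← ENNReal.ofReal_add (Real.exp_nonneg _) (Real.exp_nonneg _),
        ← ENNReal.ofReal_add (Real.exp_nonneg _) (Real.exp_nonneg _)]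
      refine ENNReal.ofReal_le_ofReal ?_
      rw [sub_eq_add_neg, sub_eq_add_neg, Real.exp_add, Real.exp_add, ← add_mul, ← two_mul]
      refine mul_le_mul_of_nonneg_right ?_ (Real.exp_nonneg _)
      linarith [Real.add_one_le_exp (inner ℝ v δ : ℝ), Real.add_one_le_exp (-inner ℝ v δ : ℝ)]
    exact (ENNReal.mul_le_mul_iff_right (by norm_num) (by norm_num)).1 h2
  refine le_trans ?_ hsym
  have hmass := studentVec_l1Ball_ge (d := d) hτ hd hr
  -- Tangent to exp(-x) at x = 2M. Since `B` is only known to have mass 1/2, this point makes (1 +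
  -- 2M)/2 - M equal to 1/2, whatever M is.
  have htan : ∀ δ, ENNReal.ofReal (Real.exp (-(2 * M)) * (1 + 2 * M))
      ≤ ENNReal.ofReal (Real.exp (-q δ))
        + ENNReal.ofReal (Real.exp (-(2 * M))) * ENNReal.ofReal (q δ) := by
    intro δ
    rw [← ENNReal.ofReal_mul (Real.exp_nonneg _), ← ENNReal.ofReal_add (Real.exp_nonneg _)
      (mul_nonneg (Real.exp_nonneg _) (hq0 δ))]
    refine ENNReal.ofReal_le_ofReal ?_
    have h1 : Real.exp (-q δ) = Real.exp (-(2 * M)) * Real.exp (2 * M - q δ) := by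
      rw [← Real.exp_add]
      ring_nf
    rw [h1, ← mul_add]
    refine mul_le_mul_of_nonneg_left ?_ (Real.exp_nonneg _)
    linarith [Real.add_one_le_exp (2 * M - q δ)]
  have hint := lintegral_mono (μ := ρ.restrict B) htan
  rw [lintegral_add_left (by fun_prop), lintegral_const_mul _ (by fun_prop), lintegral_const,
    Measure.restrict_apply_univ] at hint
  have hlow : ENNReal.ofReal (Real.exp (-(2 * M)) * M + Real.exp (-(2 * M)) / 2)
      ≤ ENNReal.ofReal (Real.exp (-(2 * M)) * (1 + 2 * M)) * ρ B := by
    calc ENNReal.ofReal (Real.exp (-(2 * M)) * M + Real.exp (-(2 * M)) / 2)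
        = ENNReal.ofReal (Real.exp (-(2 * M)) * (1 + 2 * M)) * 2⁻¹ := by
          rw [show (2⁻¹ : ENNReal) = ENNReal.ofReal 2⁻¹ by
            rw [ENNReal.ofReal_inv_of_pos two_pos, ENNReal.ofReal_ofNat],
            ← ENNReal.ofReal_mul (by positivity)]
          congr 1
          ring
      _ ≤ _ := by gcongr
  have hup : ENNReal.ofReal (Real.exp (-(2 * M))) * ∫⁻ δ in B, ENNReal.ofReal (q δ) ∂ρ
      ≤ ENNReal.ofReal (Real.exp (-(2 * M)) * M) := by
    rw [ENNReal.ofReal_mul (Real.exp_nonneg _)]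
    gcongr
    exact (setLIntegral_le_lintegral _ _).trans hqM
  have h := (hlow.trans hint).trans (add_le_add_right hup _)
  rw [ENNReal.ofReal_add (by positivity) (by positivity), add_comm] at h
  exact (ENNReal.add_le_add_iff_right ENNReal.ofReal_ne_top).1 h

end Evidence

/-! ### Likelihood ratios near the true parameter and the resulting evidence bound. -/

section Likelihood

variable {n d : ℕ}

/-- Taking σ ≥ σ₀ makes the squared-residual term nonnegative, so it can be dropped. The upper end
of the window limits the loss σ₀/σ to exp(-1/(2n)) per observation, hence exp(-1/2) for the sample.
-/
lemma density_ratio_ge (hn : 0 < n) (θ₀ δ : Vec d) {σ₀ σ : ℝ} (hσ₀ : 0 < σ₀) (hσ : 0 < σ)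
    (h1 : σ₀ ^ 2 ≤ σ ^ 2) (h2 : σ ^ 2 ≤ σ₀ ^ 2 + σ₀ ^ 2 / n) (z : ℝ × Vec d) :
    Real.exp (-(1 / (2 * n)) + ((σ ^ 2)⁻¹ * (z.1 - inner ℝ z.2 θ₀) * inner ℝ z.2 δ
        - (2 * σ₀ ^ 2)⁻¹ * (inner ℝ z.2 δ) ^ 2))
      ≤ modelDensity (θ₀ + δ) σ z / modelDensity θ₀ σ₀ z := by
  have hn' : (0 : ℝ) < n := by exact_mod_cast hn
  rw [modelDensity_eq _ hσ, modelDensity_eq _ hσ₀, inner_add_right]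
  generalize (inner ℝ z.2 θ₀ : ℝ) = m
  generalize (inner ℝ z.2 δ : ℝ) = w
  have hπ : 0 < (√(2 * Real.pi))⁻¹ := by positivity
  have e : (√(2 * Real.pi))⁻¹ * σ⁻¹ * Real.exp (-(z.1 - (m + w)) ^ 2 / (2 * σ ^ 2))
        / ((√(2 * Real.pi))⁻¹ * σ₀⁻¹ * Real.exp (-(z.1 - m) ^ 2 / (2 * σ₀ ^ 2)))
      = (σ₀ / σ) * Real.exp (-(z.1 - (m + w)) ^ 2 / (2 * σ ^ 2)
          - -(z.1 - m) ^ 2 / (2 * σ₀ ^ 2)) := by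
    rw [Real.exp_sub]
    field_simp
  rw [e, Real.exp_add]
  have hs : Real.exp (-(1 / (2 * n))) ≤ σ₀ / σ := by
    rw [Real.exp_neg, inv_le_comm₀ (Real.exp_pos _) (by positivity), inv_div]
    refine le_of_sq_le_sq ?_ (Real.exp_nonneg _)
    rw [div_pow, ← Real.exp_nat_mul, div_le_iff₀ (by positivity)]
    have h3 := Real.add_one_le_exp ((2 : ℕ) * (1 / (2 * (n : ℝ))))
    have h4 : ((2 : ℕ) * (1 / (2 * (n : ℝ)))) = 1 / n := by
      push_cast
      field_simp
    rw [h4] at h3 ⊢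
    calc σ ^ 2 ≤ (1 / n + 1) * σ₀ ^ 2 := by
          refine h2.trans_eq ?_
          ring
      _ ≤ _ := by gcongr
  have he : (σ ^ 2)⁻¹ * (z.1 - m) * w - (2 * σ₀ ^ 2)⁻¹ * w ^ 2
      ≤ -(z.1 - (m + w)) ^ 2 / (2 * σ ^ 2) - -(z.1 - m) ^ 2 / (2 * σ₀ ^ 2) := by
    have hi : (σ ^ 2)⁻¹ ≤ (σ₀ ^ 2)⁻¹ := inv_anti₀ (by positivity) h1
    have e1 : -(z.1 - (m + w)) ^ 2 / (2 * σ ^ 2) - -(z.1 - m) ^ 2 / (2 * σ₀ ^ 2)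
        = (σ ^ 2)⁻¹ * (z.1 - m) * w - (σ ^ 2)⁻¹ / 2 * w ^ 2
          + (z.1 - m) ^ 2 / 2 * ((σ₀ ^ 2)⁻¹ - (σ ^ 2)⁻¹) := by
      field_simp
      ring
    have e2 : (2 * σ₀ ^ 2)⁻¹ = (σ₀ ^ 2)⁻¹ / 2 := by
      rw [mul_inv]
      ring
    rw [e1, e2]
    nlinarith [mul_nonneg (sq_nonneg (z.1 - m)) (sub_nonneg.2 hi),
      mul_nonneg (sq_nonneg w) (sub_nonneg.2 hi)]
  gcongr

lemma likelihoodRatio_ge (hn : 0 < n) (θ₀ δ : Vec d) {σ₀ σ : ℝ} (hσ₀ : 0 < σ₀) (hσ : 0 < σ)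
    (h1 : σ₀ ^ 2 ≤ σ ^ 2) (h2 : σ ^ 2 ≤ σ₀ ^ 2 + σ₀ ^ 2 / n) (z : Fin n → ℝ × Vec d) :
    Real.exp (-(1 / 2) + (inner ℝ ((σ ^ 2)⁻¹ • ∑ i, ((z i).1 - inner ℝ (z i).2 θ₀) • (z i).2) δ
        - (2 * σ₀ ^ 2)⁻¹ * ∑ i, (inner ℝ (z i).2 δ) ^ 2))
      ≤ likelihoodRatio θ₀ σ₀ z (θ₀ + δ, σ) := by
  have hn' : (n : ℝ) ≠ 0 := by exact_mod_cast hn.ne'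
  rw [likelihoodRatio]
  refine le_of_eq_of_le ?_ (Finset.prod_le_prod (fun i _ => Real.exp_nonneg _) fun i _ =>
    density_ratio_ge hn θ₀ δ hσ₀ hσ h1 h2 (z i))
  rw [← Real.exp_sum]
  congr 1
  rw [Finset.sum_add_distrib, Finset.sum_sub_distrib, real_inner_smul_left, sum_inner,
    Finset.mul_sum, Finset.mul_sum]
  simp only [real_inner_smul_left, ← mul_assoc]
  congr 1
  simp only [Finset.sum_const, Finset.card_univ, Fintype.card_fin, nsmul_eq_mul]
  field_simp

/-- Lower bound on the evidence for a fixed variance. -/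
lemma lintegral_likelihoodRatio_studentPrior_ge (hn : 0 < n) (hd : 0 < d) {τ η : ℝ} (hτ : 0 < τ)
    (hη : 0 < η) (hη1 : η ≤ 1) {C₁ : ℝ} {θ₀ : Vec d} (hθ₀ : l1Norm θ₀ ≤ C₁ - 2 * d * τ)
    {σ₀ σ α : ℝ} (hα0 : 0 < α) (hα1 : α < 1) (hσ₀ : 0 < σ₀) (hσ : 0 < σ)
    (h1 : σ₀ ^ 2 ≤ σ ^ 2) (h2 : σ ^ 2 ≤ σ₀ ^ 2 + σ₀ ^ 2 / n) (z : Fin n → ℝ × Vec d) :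
    ENNReal.ofReal ((∏ i, (η ^ 4 * ((1 + |θ₀ i| / τ) ^ 4)⁻¹))
        * (Real.exp (-(1 / 2)) * (Real.exp (-(α * ((η * τ) ^ 2 / σ₀ ^ 2
          * ∑ i, ‖(z i).2‖ ^ 2))) / 2)))
      ≤ ∫⁻ θ, ENNReal.ofReal (likelihoodRatio θ₀ σ₀ z (θ, σ) ^ α) ∂studentPrior d τ C₁ := by
  have hlr : Measurable fun θ : Vec d => likelihoodRatio θ₀ σ₀ z (θ, σ) :=
    (measurable_likelihoodRatio θ₀ σ₀).comp
      (f := fun θ : Vec d => (z, (θ, σ))) (by fun_prop)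
  refine le_trans ?_ (lintegral_studentPrior_ge hτ hη hη1 hθ₀ (by fun_prop))
  rw [ENNReal.ofReal_mul (Finset.prod_nonneg fun i _ => by positivity)]
  refine mul_le_mul_right ?_ _
  -- The linear form `v` contains all the residuals; `q` is the quadratic part already scaled by α,
  -- and `M` its mean under the Student law of scale ητ.
  set v : Vec d := (σ ^ 2)⁻¹ • ∑ i, ((z i).1 - inner ℝ (z i).2 θ₀) • (z i).2 with hv
  set q : Vec d → ℝ := fun δ => α * ((2 * σ₀ ^ 2)⁻¹ * ∑ i, (inner ℝ (z i).2 δ) ^ 2) with hq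
  set M : ℝ := α * ((2 * σ₀ ^ 2)⁻¹ * ∑ i, (η * τ) ^ 2 * ‖(z i).2‖ ^ 2) with hM
  have hτ' : 0 < η * τ := mul_pos hη hτ
  have hqM : ∫⁻ δ, ENNReal.ofReal (q δ) ∂studentVec d (η * τ) ≤ ENNReal.ofReal M := by
    have hc : 0 ≤ α * (2 * σ₀ ^ 2)⁻¹ := by positivity
    simp only [hq, hM, ← mul_assoc α, ENNReal.ofReal_mul hc]
    rw [lintegral_const_mul _ (by fun_prop),
      ENNReal.ofReal_sum_of_nonneg fun i _ => by positivity]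
    refine mul_le_mul_right (le_of_eq ?_) _
    simp only [ENNReal.ofReal_sum_of_nonneg fun (i : Fin n) _ => sq_nonneg
      (inner ℝ (z i).2 _ : ℝ)]
    rw [lintegral_finsetSum _ fun i _ => by fun_prop]
    exact Finset.sum_congr rfl fun i _ => lintegral_inner_sq_studentVec hτ' _
  have h := setLIntegral_exp_inner_sub_ge hτ' hd (mul_le_of_le_one_left hτ.le hη1) (α • v)
    (q := q) (by fun_prop) (fun δ => by positivity) (fun δ => by simp [hq]) (M := M)
    (by positivity) hqM
  have e : 2 * M = α * ((η * τ) ^ 2 / σ₀ ^ 2 * ∑ i, ‖(z i).2‖ ^ 2) := by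
    rw [hM, ← Finset.mul_sum]
    field_simp
  rw [e] at h
  rw [ENNReal.ofReal_mul (Real.exp_nonneg _)]
  refine (mul_le_mul_right h _).trans ?_
  rw [← lintegral_const_mul _ (by fun_prop)]
  refine lintegral_mono fun δ => ?_
  rw [← ENNReal.ofReal_mul (Real.exp_nonneg _), ← Real.exp_add]
  refine ENNReal.ofReal_le_ofReal ?_
  have h3 := Real.rpow_le_rpow (Real.exp_nonneg _)
    (likelihoodRatio_ge hn θ₀ δ hσ₀ hσ h1 h2 z) hα0.le
  refine le_trans ?_ h3
  rw [← Real.exp_mul, real_inner_smul_left]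
  -- The constant -α/2 coming from the power α is at least -1/2 because α < 1.
  refine Real.exp_le_exp.2 ?_
  simp only [hq]
  nlinarith

/-- Lower bound on the evidence. -/
lemma lintegral_likelihoodRatio_prior_ge (hn : 0 < n) (hd : 0 < d) {τ η : ℝ} (hτ : 0 < τ)
    (hη : 0 < η) (hη1 : η ≤ 1) {C₁ : ℝ} {θ₀ : Vec d} (hθ₀ : l1Norm θ₀ ≤ C₁ - 2 * d * τ)
    {σ₀ α a b : ℝ} (hα0 : 0 < α) (hα1 : α < 1) (hσ₀ : 0 < σ₀) (ha : 0 < a) (hb : 0 < b)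
    {S : ℝ} (hS : 2 * σ₀ ^ 2 ≤ S) (z : Fin n → ℝ × Vec d) :
    ENNReal.ofReal ((∏ i, (η ^ 4 * ((1 + |θ₀ i| / τ) ^ 4)⁻¹))
        * (Real.exp (-(1 / 2)) * (Real.exp (-(α * ((η * τ) ^ 2 / σ₀ ^ 2
          * ∑ i, ‖(z i).2‖ ^ 2))) / 2))
        * (b ^ a / Real.Gamma a * S ^ (-a - 1) * Real.exp (-b / σ₀ ^ 2) * (σ₀ ^ 2 / n)))
      ≤ ∫⁻ p, ENNReal.ofReal (likelihoodRatio θ₀ σ₀ z p ^ α) ∂prior d τ C₁ a b := by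
  have hn' : (1 : ℝ) ≤ n := by exact_mod_cast hn
  have hlr : Measurable fun p : Vec d × ℝ => likelihoodRatio θ₀ σ₀ z p :=
    (measurable_likelihoodRatio θ₀ σ₀).comp
      (f := fun p : Vec d × ℝ => (z, p)) (by fun_prop)
  have hfin : IsFiniteMeasure (inverseGamma a b) :=
    ⟨(inverseGamma_univ_le_one ha hb).trans_lt ENNReal.one_lt_top⟩
  set A : Set ℝ := {σ | 0 < σ ∧ σ₀ ^ 2 ≤ σ ^ 2 ∧ σ ^ 2 ≤ σ₀ ^ 2 + σ₀ ^ 2 / n} with hA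
  have hAm : MeasurableSet A :=
    (measurableSet_lt measurable_const measurable_id).inter
      ((measurableSet_le measurable_const (measurable_id.pow_const 2)).inter
        (measurableSet_le (measurable_id.pow_const 2) measurable_const))
  have hσ2 : 0 < σ₀ ^ 2 := by positivity
  have hdiv : σ₀ ^ 2 / n ≤ σ₀ ^ 2 := div_le_self hσ2.le hn'
  have hmass : ENNReal.ofReal (b ^ a / Real.Gamma a * S ^ (-a - 1) * Real.exp (-b / σ₀ ^ 2)
      * (σ₀ ^ 2 / n)) ≤ (inverseGamma a b).map Real.sqrt A := by
    refine (inverseGamma_Icc_ge ha hb hσ2 (by positivity) (by linarith)).trans ?_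
    rw [Measure.map_apply (by fun_prop) hAm]
    refine measure_mono fun v hv => ?_
    have hv0 : 0 < v := lt_of_lt_of_le hσ2 hv.1
    refine ⟨Real.sqrt_pos.2 hv0, ?_⟩
    rw [Real.sq_sqrt hv0.le]
    exact hv
  rw [prior, lintegral_prod_symm _ (by fun_prop), ENNReal.ofReal_mul (mul_nonneg
    (Finset.prod_nonneg fun i _ => by positivity) (by positivity))]
  refine (mul_le_mul_right hmass _).trans ?_
  rw [← setLIntegral_const]
  refine le_trans (setLIntegral_mono' hAm fun σ hσ => ?_) (setLIntegral_le_lintegral A _)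
  exact lintegral_likelihoodRatio_studentPrior_ge hn hd hτ hη hη1 hθ₀ hα0 hα1 hσ₀ hσ.1 hσ.2.1
    hσ.2.2 z

end Likelihood

/-! ### Posterior normalisation, moment bounds and the exceptional event. -/

section Deviation

variable {n d : ℕ}

lemma prior_univ_le_one (d : ℕ) (τ C₁ : ℝ) {a b : ℝ} (ha : 0 < a) (hb : 0 < b) :
    prior d τ C₁ a b Set.univ ≤ 1 := by
  have hfin : IsFiniteMeasure (inverseGamma a b) :=
    ⟨(inverseGamma_univ_le_one ha hb).trans_lt ENNReal.one_lt_top⟩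
  rw [prior, ← Set.univ_prod_univ, Measure.prod_prod, Measure.map_apply (by fun_prop) .univ,
    Set.preimage_univ]
  exact mul_le_one' (normalized_univ_le_one _) (inverseGamma_univ_le_one ha hb)

lemma prior_ae_pos (d : ℕ) (τ C₁ : ℝ) {a b : ℝ} (ha : 0 < a) (hb : 0 < b) :
    ∀ᵐ p ∂prior d τ C₁ a b, 0 < p.2 := by
  have hfin : IsFiniteMeasure (inverseGamma a b) :=
    ⟨(inverseGamma_univ_le_one ha hb).trans_lt ENNReal.one_lt_top⟩
  exact Measure.quasiMeasurePreserving_snd.ae (map_sqrt_inverseGamma_ae_pos a b)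

/-- The factor L_n(θ₀, σ₀)^α is positive and does not depend on the parameter, so it cancels in the
normalisation. -/
lemma fractionalPosterior_eq (π : Measure (Vec d × ℝ)) (α : ℝ) (z : Fin n → ℝ × Vec d)
    (θ₀ : Vec d) {σ₀ : ℝ} (hσ₀ : 0 < σ₀) :
    fractionalPosterior π α z
      = normalized (π.withDensity fun p => ENNReal.ofReal (likelihoodRatio θ₀ σ₀ z p ^ α)) := by
  have hlr : Measurable fun p : Vec d × ℝ => likelihoodRatio θ₀ σ₀ z p :=
    (measurable_likelihoodRatio θ₀ σ₀).comp
      (f := fun p : Vec d × ℝ => (z, p)) (by fun_prop)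
  have hL : 0 < likelihood z θ₀ σ₀ ^ α := Real.rpow_pos_of_pos (likelihood_pos θ₀ hσ₀ z) _
  have e : (fun p : Vec d × ℝ => ENNReal.ofReal (likelihood z p.1 p.2 ^ α))
      = ENNReal.ofReal (likelihood z θ₀ σ₀ ^ α) •
        fun p => ENNReal.ofReal (likelihoodRatio θ₀ σ₀ z p ^ α) := by
    funext p
    rw [Pi.smul_apply, smul_eq_mul, ← ENNReal.ofReal_mul hL.le,
      ← Real.mul_rpow (likelihood_pos θ₀ hσ₀ z).le (likelihoodRatio_nonneg _ _ _ _),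
      ← likelihood_eq_mul_ratio θ₀ hσ₀]
  rw [fractionalPosterior, e, withDensity_smul _ (by fun_prop),
    normalized_smul _ (by simpa using hL) ENNReal.ofReal_ne_top]

/-- The exponential moment of the Hellinger distance under the unnormalised posterior. -/
def exponentialMoment (PX : Measure (Vec d)) (θ₀ : Vec d) (σ₀ α : ℝ) (π : Measure (Vec d × ℝ))
    (z : Fin n → ℝ × Vec d) : ENNReal :=
  ∫⁻ p, ENNReal.ofReal (likelihoodRatio θ₀ σ₀ z p ^ α
    * Real.exp (n * min α (1 - α) * modelHellinger PX θ₀ σ₀ p)) ∂π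

lemma measurable_exponentialMoment_integrand (PX : Measure (Vec d)) [IsProbabilityMeasure PX]
    (θ₀ : Vec d) (σ₀ α : ℝ) :
    Measurable fun x : (Fin n → ℝ × Vec d) × (Vec d × ℝ) =>
      ENNReal.ofReal (likelihoodRatio θ₀ σ₀ x.1 x.2 ^ α
        * Real.exp (n * min α (1 - α) * modelHellinger PX θ₀ σ₀ x.2)) := by
  have h1 := measurable_likelihoodRatio (n := n) θ₀ σ₀
  have h2 := measurable_modelHellinger PX θ₀ σ₀
  fun_prop

/-- After swapping the integrals, the weight exp(n m H²) exactly cancels the affinity bound at each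
parameter with σ > 0. -/
lemma lintegral_exponentialMoment_le (PX : Measure (Vec d)) [IsProbabilityMeasure PX]
    (θ₀ : Vec d) {σ₀ α : ℝ} (hσ₀ : 0 < σ₀) (hα0 : 0 < α) (hα1 : α < 1)
    (π : Measure (Vec d × ℝ)) (hπ : π Set.univ ≤ 1) (hpos : ∀ᵐ p ∂π, 0 < p.2) :
    ∫⁻ z, exponentialMoment PX θ₀ σ₀ α π z
      ∂(Measure.pi fun _ : Fin n => modelLaw PX θ₀ σ₀) ≤ 1 := by
  have : IsFiniteMeasure π := ⟨hπ.trans_lt ENNReal.one_lt_top⟩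
  have hZ : iIndepFun (fun (i : Fin n) (z : Fin n → ℝ × Vec d) => z i)
      (Measure.pi fun _ : Fin n => modelLaw PX θ₀ σ₀) :=
    iIndepFun_pi (X := fun _ x => x) fun _ => aemeasurable_id'
  have hlaw : ∀ i : Fin n, HasLaw (fun z : Fin n → ℝ × Vec d => z i) (modelLaw PX θ₀ σ₀)
      (Measure.pi fun _ : Fin n => modelLaw PX θ₀ σ₀) := fun i =>
    (measurePreserving_eval (fun _ : Fin n => modelLaw PX θ₀ σ₀) i).hasLaw
  simp only [exponentialMoment]
  rw [lintegral_lintegral_swap (measurable_exponentialMoment_integrand PX θ₀ σ₀ α).aemeasurable]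
  calc _ ≤ ∫⁻ _, 1 ∂π := lintegral_mono_ae ?_
    _ ≤ 1 := by simpa using hπ
  filter_upwards [hpos] with p hp
  have hlr : Measurable fun z : Fin n → ℝ × Vec d => likelihoodRatio θ₀ σ₀ z p :=
    (measurable_likelihoodRatio θ₀ σ₀).comp
      (f := fun z : Fin n → ℝ × Vec d => (z, p)) (by fun_prop)
  simp only [ENNReal.ofReal_mul (Real.rpow_nonneg (likelihoodRatio_nonneg θ₀ σ₀ _ p) α)]
  rw [lintegral_mul_const _ (by fun_prop)]
  refine (mul_le_mul_left (lintegral_likelihoodRatio_rpow_le PX θ₀ hσ₀ hp hα0 hα1 hZ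
    (fun i => by fun_prop) hlaw) _).trans_eq ?_
  rw [← ENNReal.ofReal_mul (Real.exp_nonneg _), ← Real.exp_add]
  simp

lemma lintegral_norm_sq_modelLaw (PX : Measure (Vec d)) [IsProbabilityMeasure PX] (θ : Vec d)
    (σ : ℝ) : ∫⁻ z, ENNReal.ofReal (‖z.2‖ ^ 2) ∂modelLaw PX θ σ
      = ∫⁻ x, ENNReal.ofReal (‖x‖ ^ 2) ∂PX := by
  rw [modelLaw, lintegral_map (by fun_prop) (by fun_prop), lintegral_prod _ (by fun_prop)]
  simp

lemma lintegral_sum_norm_sq_le (PX : Measure (Vec d)) [IsProbabilityMeasure PX] (θ₀ : Vec d)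
    (σ₀ : ℝ) {Cx k : ℝ} (hk : 0 ≤ k) (hint : Integrable (fun x => ‖x‖ ^ 2) PX)
    (hCx : ∫ x, ‖x‖ ^ 2 ∂PX < Cx ^ 2) :
    ∫⁻ z, ENNReal.ofReal (k * ∑ i, ‖(z i).2‖ ^ 2)
      ∂(Measure.pi fun _ : Fin n => modelLaw PX θ₀ σ₀) ≤ ENNReal.ofReal (k * (n * Cx ^ 2)) := by
  simp only [ENNReal.ofReal_mul hk]
  rw [lintegral_const_mul _ (by fun_prop)]
  refine mul_le_mul_right ?_ _
  simp only [ENNReal.ofReal_sum_of_nonneg fun (i : Fin n) _ => sq_nonneg (‖(_ : Vec d)‖)]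
  rw [lintegral_finsetSum _ fun i _ => by fun_prop]
  have h : ∀ i : Fin n, ∫⁻ z : Fin n → ℝ × Vec d, ENNReal.ofReal (‖(z i).2‖ ^ 2)
      ∂(Measure.pi fun _ : Fin n => modelLaw PX θ₀ σ₀) ≤ ENNReal.ofReal (Cx ^ 2) := by
    intro i
    have hlaw : HasLaw (fun z : Fin n → ℝ × Vec d => z i) (modelLaw PX θ₀ σ₀)
      (Measure.pi fun _ : Fin n => modelLaw PX θ₀ σ₀) :=
      (measurePreserving_eval (fun _ : Fin n => modelLaw PX θ₀ σ₀) i).hasLaw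
    rw [hlaw.lintegral_comp (f := fun z => ENNReal.ofReal (‖z.2‖ ^ 2)) (by fun_prop),
      lintegral_norm_sq_modelLaw, ← ofReal_integral_eq_lintegral_ofReal hint
      (.of_forall fun x => sq_nonneg _)]
    exact ENNReal.ofReal_le_ofReal hCx.le
  refine (Finset.sum_le_sum fun i _ => h i).trans_eq ?_
  rw [ENNReal.ofReal_mul (Nat.cast_nonneg n)]
  simp

/-- The posterior risk bounds on the event where the exponential moment is small and the evidence
is large. -/
lemma posterior_risk_le (PX : Measure (Vec d)) [IsProbabilityMeasure PX] (hn : 0 < n)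
    (θ₀ : Vec d) {σ₀ α : ℝ} (hσ₀ : 0 < σ₀) (hα0 : 0 < α) (hα1 : α < 1)
    (π : Measure (Vec d × ℝ)) (hpos : ∀ᵐ p ∂π, 0 < p.2) {ε : ℝ} (hε : 0 < ε)
    (z : Fin n → ℝ × Vec d)
    (hG : exponentialMoment PX θ₀ σ₀ α π z ≤ ENNReal.ofReal (Real.exp (n * ε / 2)))
    (hD : ENNReal.ofReal (Real.exp (-(n * ε / 2 + α * (n * ε / 2))))
      ≤ ∫⁻ p, ENNReal.ofReal (likelihoodRatio θ₀ σ₀ z p ^ α) ∂π) :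
    ∫⁻ p, ENNReal.ofReal (hellingerSq (modelLaw PX p.1 p.2) (modelLaw PX θ₀ σ₀))
          ∂(fractionalPosterior π α z) ≤ ENNReal.ofReal (kappa α * ε) ∧
      ∫⁻ p, ENNReal.ofReal (tvDist (modelLaw PX p.1 p.2) (modelLaw PX θ₀ σ₀) ^ 2)
          ∂(fractionalPosterior π α z)
        ≤ ENNReal.ofReal (4 * (α + 1) / ((1 - α) * α) * ε) := by
  have hn' : (0 : ℝ) < n := by exact_mod_cast hn
  have hα1' : 0 < 1 - α := by linarith
  obtain ⟨m, hm⟩ : ∃ m, m = min α (1 - α) := ⟨_, rfl⟩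
  have hm0 : 0 < m := hm ▸ lt_min hα0 hα1'
  have hlr : Measurable fun p : Vec d × ℝ => likelihoodRatio θ₀ σ₀ z p :=
    (measurable_likelihoodRatio θ₀ σ₀).comp
      (f := fun p : Vec d × ℝ => (z, p)) (by fun_prop)
  have hnε : 0 < n * ε := mul_pos hn' hε
  have hpost := fractionalPosterior_eq π α z θ₀ hσ₀
  have hae : ∀ᵐ p ∂fractionalPosterior π α z, 0 < p.2 := by
    have hac : fractionalPosterior π α z ≪ π := by
      rw [hpost, normalized]
      exact Measure.smul_absolutelyContinuous.trans (withDensity_absolutelyContinuous _ _)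
    exact hac.ae_le hpos
  have hH : ∫⁻ p, ENNReal.ofReal (modelHellinger PX θ₀ σ₀ p) ∂fractionalPosterior π α z
      ≤ ENNReal.ofReal ((α + 1) / m * ε) := by
    rw [hpost]
    have hD0 : ∫⁻ p, ENNReal.ofReal (likelihoodRatio θ₀ σ₀ z p ^ α) ∂π ≠ 0 :=
      (lt_of_lt_of_le (ENNReal.ofReal_pos.2 (Real.exp_pos _)) hD).ne'
    -- The exponent t adds nε/2 from the moment to (1 + α)nε/2 from the evidence; the total (1 +
    -- α/2)nε is relaxed to (1 + α)nε.
    refine (lintegral_normalized_withDensity_le π (k := n * m)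
      (t := n * ε / 2 + (n * ε / 2 + α * (n * ε / 2))) (by fun_prop)
      (fun p => Real.rpow_nonneg (likelihoodRatio_nonneg _ _ _ _) _)
      (measurable_modelHellinger PX θ₀ σ₀) (modelHellinger_nonneg PX θ₀ σ₀) (by positivity)
      hD0 ?_ ?_ (by positivity)).trans (ENNReal.ofReal_le_ofReal ?_)
    · rw [hm]
      exact ne_top_of_le_ne_top ENNReal.ofReal_ne_top hG
    · rw [hm]
      refine hG.trans (le_trans ?_ (mul_le_mul_right hD _))
      rw [← ENNReal.ofReal_mul (Real.exp_nonneg _), ← Real.exp_add]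
      refine ENNReal.ofReal_le_ofReal (Real.exp_le_exp.2 (le_of_eq ?_))
      ring
    · rw [div_mul_eq_mul_div, div_le_div_iff₀ (by positivity) hm0]
      have : 0 ≤ α * (n * ε) * m := by positivity
      nlinarith
  constructor
  · calc _ = ∫⁻ p, ENNReal.ofReal (modelHellinger PX θ₀ σ₀ p) ∂fractionalPosterior π α z := by
          refine lintegral_congr_ae ?_
          filter_upwards [hae] with p hp
          rw [hellingerSq_modelLaw PX θ₀ hσ₀ p.1 hp]
      _ ≤ _ := hH
      -- The stated constant is twice (α + 1)/m, so there is room to spare.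
      _ ≤ _ := by
        refine ENNReal.ofReal_le_ofReal (mul_le_mul_of_nonneg_right ?_ hε.le)
        rw [kappa]
        split_ifs with h
        · rw [hm, min_eq_right (by linarith)]
          gcongr
          linarith
        · rw [hm, min_eq_left (by linarith)]
          gcongr
          linarith
  · calc _ ≤ ∫⁻ p, ENNReal.ofReal 4 * ENNReal.ofReal (modelHellinger PX θ₀ σ₀ p)
            ∂fractionalPosterior π α z := by
          refine lintegral_mono_ae ?_
          filter_upwards [hae] with p hp
          rw [← ENNReal.ofReal_mul (by norm_num)]
          exact ENNReal.ofReal_le_ofReal (tvDist_modelLaw_sq_le PX θ₀ hσ₀ p.1 hp)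
      _ = ENNReal.ofReal 4 * ∫⁻ p, ENNReal.ofReal (modelHellinger PX θ₀ σ₀ p)
            ∂fractionalPosterior π α z :=
          lintegral_const_mul _ (measurable_modelHellinger PX θ₀ σ₀).ennreal_ofReal
      _ ≤ ENNReal.ofReal 4 * ENNReal.ofReal ((α + 1) / m * ε) := mul_le_mul_right hH _
      _ ≤ _ := by
        rw [← ENNReal.ofReal_mul (by norm_num)]
        refine ENNReal.ofReal_le_ofReal ?_
        rw [← mul_assoc, ← mul_div_assoc]
        have : (1 - α) * α ≤ m := by
          rw [hm]
          exact le_min (by nlinarith) (by nlinarith)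
        gcongr

/-- The probability of the exceptional event. -/
lemma pi_modelLaw_exceptional_le (PX : Measure (Vec d)) [IsProbabilityMeasure PX]
    (θ₀ : Vec d) {σ₀ α : ℝ} (hσ₀ : 0 < σ₀) (hα0 : 0 < α) (hα1 : α < 1)
    (π : Measure (Vec d × ℝ)) (hπ : π Set.univ ≤ 1) (hpos : ∀ᵐ p ∂π, 0 < p.2)
    {Cx k E : ℝ} (hk : 0 ≤ k) (hE : 0 < E) (hint : Integrable (fun x => ‖x‖ ^ 2) PX)
    (hCx : ∫ x, ‖x‖ ^ 2 ∂PX < Cx ^ 2) (hkC : k * (n * Cx ^ 2) ≤ 1 / 2) :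
    (Measure.pi fun _ : Fin n => modelLaw PX θ₀ σ₀)
      ({z | ENNReal.ofReal (Real.exp (E / 2)) ≤ exponentialMoment PX θ₀ σ₀ α π z}
        ∪ {z | ENNReal.ofReal (E / 2) ≤ ENNReal.ofReal (k * ∑ i, ‖(z i).2‖ ^ 2)})
      ≤ ENNReal.ofReal (2 / E) := by
  have : IsFiniteMeasure π := ⟨hπ.trans_lt ENNReal.one_lt_top⟩
  have hGm : Measurable fun z : Fin n → ℝ × Vec d => exponentialMoment PX θ₀ σ₀ α π z :=
    (measurable_exponentialMoment_integrand PX θ₀ σ₀ α).lintegral_prod_right'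
  have e : ENNReal.ofReal (2 / E) = ENNReal.ofReal (1 / E) + ENNReal.ofReal (1 / E) := by
    rw [← ENNReal.ofReal_add (by positivity) (by positivity)]
    congr 1
    ring
  rw [e]
  refine (measure_union_le _ _).trans (add_le_add ?_ ?_)
  · refine (meas_ge_le_lintegral_div hGm.aemeasurable
      (ENNReal.ofReal_pos.2 (Real.exp_pos _)).ne' ENNReal.ofReal_ne_top).trans ?_
    refine (ENNReal.div_le_div_right
      (lintegral_exponentialMoment_le PX θ₀ hσ₀ hα0 hα1 π hπ hpos) _).trans ?_
    rw [← ENNReal.ofReal_one, ← ENNReal.ofReal_div_of_pos (Real.exp_pos _)]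
    refine ENNReal.ofReal_le_ofReal (one_div_le_one_div_of_le hE ?_)
    -- Gives exp(E/2) ≥ E, since 1 + x + x²/2 ≥ 2x.
    have := Real.quadratic_le_exp_of_nonneg (x := E / 2) (by positivity)
    nlinarith [sq_nonneg (E / 2 - 1)]
  · refine (meas_ge_le_lintegral_div (Measurable.aemeasurable (by fun_prop))
      (ENNReal.ofReal_pos.2 (by positivity)).ne' ENNReal.ofReal_ne_top).trans ?_
    refine (ENNReal.div_le_div_right (lintegral_sum_norm_sq_le PX θ₀ σ₀ hk hint hCx) _).trans ?_
    rw [← ENNReal.ofReal_div_of_pos (by positivity)]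
    refine ENNReal.ofReal_le_ofReal ?_
    rw [div_le_div_iff₀ (by positivity) hE]
    nlinarith

end Deviation

/-! ### Comparing the evidence cost with the rate. -/

section Rate

variable {d : ℕ}

/-- Jensen for the concave logarithm over the support of θ₀, carried out with the tangent at R: the
mean of |θ₀ᵢ|/τ over the support is at most R, so the linear corrections sum to something
nonpositive. -/
lemma sum_log_one_add_le (θ₀ : Vec d) {τ R : ℝ} (hτ : 0 < τ) (hR : 0 ≤ R)
    (h : l1Norm θ₀ ≤ R * (l0Norm θ₀ * τ)) :
    ∑ i, Real.log (1 + |θ₀ i| / τ) ≤ l0Norm θ₀ * Real.log (1 + R) := by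
  have hR1 : 0 < 1 + R := by linarith
  have e : ∑ i, Real.log (1 + |θ₀ i| / τ)
      = ∑ i with θ₀ i ≠ 0, Real.log (1 + |θ₀ i| / τ) := by
    refine (Finset.sum_filter_of_ne (p := fun i => θ₀ i ≠ 0) fun i _ hi h0 => hi ?_).symm
    simp [h0]
  have hpt : ∀ i, Real.log (1 + |θ₀ i| / τ)
      ≤ Real.log (1 + R) + (|θ₀ i| / τ - R) / (1 + R) := by
    intro i
    have hi : 0 < 1 + |θ₀ i| / τ := by positivity
    have := Real.log_le_sub_one_of_pos (div_pos hi hR1)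
    rw [Real.log_div hi.ne' hR1.ne'] at this
    have e2 : (1 + |θ₀ i| / τ) / (1 + R) - 1 = (|θ₀ i| / τ - R) / (1 + R) := by
      field_simp
      ring
    linarith
  rw [e]
  refine (Finset.sum_le_sum fun i _ => hpt i).trans ?_
  rw [Finset.sum_add_distrib, ← Finset.sum_div, Finset.sum_sub_distrib, Finset.sum_const,
    Finset.sum_const, nsmul_eq_mul, nsmul_eq_mul]
  have hsum : ∑ i with θ₀ i ≠ 0, |θ₀ i| / τ ≤ l0Norm θ₀ * R := by
    calc ∑ i with θ₀ i ≠ 0, |θ₀ i| / τ ≤ ∑ i, |θ₀ i| / τ :=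
          Finset.sum_le_sum_of_subset_of_nonneg (Finset.filter_subset _ _)
            fun i _ _ => by positivity
      _ = l1Norm θ₀ / τ := by rw [l1Norm, Finset.sum_div]
      _ ≤ _ := by
        rw [div_le_iff₀ hτ]
        linarith
  have hneg : (∑ i with θ₀ i ≠ 0, |θ₀ i| / τ - l0Norm θ₀ * R) / (1 + R) ≤ 0 :=
    div_nonpos_of_nonpos_of_nonneg (by linarith) hR1.le
  have := hneg
  rw [l0Norm] at this ⊢
  linarith

/-- The shrinkage exp(-L/d) is taken so close to 1 that its d fourth powers cost only exp(-4L), free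
of d. The 8 is 4 times the 2 in log(1 + R) ≤ 2 log R, valid as R ≥ 2. -/
lemma prod_student_factor_ge (hd : 0 < d) (θ₀ : Vec d) {τ R L : ℝ} (hτ : 0 < τ) (hR : 2 ≤ R)
    (h : l1Norm θ₀ ≤ R * (l0Norm θ₀ * τ)) :
    Real.exp (-(4 * L + 8 * (l0Norm θ₀ * Real.log R)))
      ≤ ∏ i, (Real.exp (-(L / d)) ^ 4 * ((1 + |θ₀ i| / τ) ^ 4)⁻¹) := by
  have hd' : (d : ℝ) ≠ 0 := by exact_mod_cast hd.ne'
  have e : ∏ i, (Real.exp (-(L / d)) ^ 4 * ((1 + |θ₀ i| / τ) ^ 4)⁻¹)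
      = Real.exp (-(4 * L + 4 * ∑ i, Real.log (1 + |θ₀ i| / τ))) := by
    have e1 : ∀ i, Real.exp (-(L / d)) ^ 4 * ((1 + |θ₀ i| / τ) ^ 4)⁻¹
        = Real.exp (-(4 * (L / d)) - 4 * Real.log (1 + |θ₀ i| / τ)) := by
      intro i
      have hi : 0 < 1 + |θ₀ i| / τ := by positivity
      rw [Real.exp_sub, ← Real.exp_nat_mul, div_eq_mul_inv]
      congr 2
      · push_cast
        ring
      · have := Real.exp_nat_mul (Real.log (1 + |θ₀ i| / τ)) 4
        rw [Real.exp_log hi] at this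
        exact this.symm.trans (by push_cast; rfl)
    simp only [e1]
    rw [← Real.exp_sum, Finset.sum_sub_distrib, ← Finset.mul_sum]
    congr 1
    simp only [Finset.sum_const, Finset.card_univ, Fintype.card_fin, nsmul_eq_mul]
    field_simp
    ring
  rw [e]
  refine Real.exp_le_exp.2 ?_
  have h1 := sum_log_one_add_le θ₀ hτ (by linarith) h
  have h2 : Real.log (1 + R) ≤ 2 * Real.log R := by
    rw [← Real.log_rpow (by linarith), Real.rpow_two]
    exact Real.log_le_log (by linarith) (by nlinarith)
  have h3 : (l0Norm θ₀ : ℝ) * Real.log (1 + R) ≤ l0Norm θ₀ * (2 * Real.log R) := by gcongr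
  linarith

/-- The price in n is polynomial: b^a contributes n^(-a/2) and the width of the window n^(-1).
Everything else is bounded below by a constant in σmin, σmax and a, because b ≤ 1. -/
lemma inverseGamma_factor_ge {σmin σmax a : ℝ} (hσmin : 0 < σmin) (hσmax : 0 < σmax)
    (ha : 0 < a) {n : ℕ} (hn : 0 < n) {v : ℝ} (hv : (2 * σmin)⁻¹ < v) :
    Real.exp (-(|Real.log ((Real.Gamma a)⁻¹ * (1 / σmax) ^ (-a - 1) * Real.exp (-(2 * σmin))
        * (2 * σmin)⁻¹)| + (a / 2 + 1) * Real.log n))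
      ≤ (1 / √n) ^ a / Real.Gamma a * (1 / σmax) ^ (-a - 1) * Real.exp (-(1 / √n) / v)
        * (v / n) := by
  have hn1 : (1 : ℝ) ≤ n := by exact_mod_cast hn
  have hn0 : (0 : ℝ) < n := by linarith
  have hΓ := Real.Gamma_pos_of_pos ha
  have hS : 0 < (1 / σmax) ^ (-a - 1) := Real.rpow_pos_of_pos (by positivity) _
  have hm : 0 < (2 * σmin)⁻¹ := by positivity
  have hv0 : 0 < v := hm.trans hv
  set K := (Real.Gamma a)⁻¹ * (1 / σmax) ^ (-a - 1) * Real.exp (-(2 * σmin)) * (2 * σmin)⁻¹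
    with hK
  have hK0 : 0 < K := by positivity
  have hKexp : Real.exp (-|Real.log K|) ≤ K := by
    rw [← Real.le_log_iff_exp_le hK0]
    exact neg_abs_le _
  have hpow : (1 / √n : ℝ) ^ a = Real.exp (-(a / 2 * Real.log n)) := by
    rw [Real.rpow_def_of_pos (by positivity), one_div, Real.log_inv, Real.log_sqrt hn0.le]
    congr 1
    ring
  have hexp : Real.exp (-(2 * σmin)) ≤ Real.exp (-(1 / √n) / v) := by
    refine Real.exp_le_exp.2 ?_
    rw [neg_div, neg_le_neg_iff, div_div, div_le_iff₀ (by positivity)]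
    have h1 : 1 ≤ √(n : ℝ) := Real.one_le_sqrt.2 hn1
    have h2 : 1 ≤ 2 * σmin * v := by
      rw [inv_lt_iff_one_lt_mul₀ (by positivity)] at hv
      linarith
    nlinarith
  have hlog : Real.exp (-Real.log n) = (n : ℝ)⁻¹ := by
    rw [Real.exp_neg, Real.exp_log hn0]
  calc Real.exp (-(|Real.log K| + (a / 2 + 1) * Real.log n))
      = Real.exp (-|Real.log K|) * (Real.exp (-(a / 2 * Real.log n)) * (n : ℝ)⁻¹) := by
        rw [← hlog, ← Real.exp_add, ← Real.exp_add]
        ring_nf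
    _ ≤ K * (Real.exp (-(a / 2 * Real.log n)) * (n : ℝ)⁻¹) := by gcongr
    _ = Real.exp (-(a / 2 * Real.log n)) / Real.Gamma a * (1 / σmax) ^ (-a - 1)
          * Real.exp (-(2 * σmin)) * ((2 * σmin)⁻¹ / n) := by
        rw [hK]
        ring
    _ ≤ _ := by
        rw [hpow]
        gcongr

/-- The effective dimension `s log R` dominates `log n`. -/
lemma log_le_three_mul {n s : ℕ} {R : ℝ} (hs : 1 ≤ s) (hR : 2 ≤ R) (hnR : 2 * n ≤ s * R)
    (hn : 0 < n) : Real.log n ≤ 3 * (s * Real.log R) := by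
  have hs' : (1 : ℝ) ≤ s := by exact_mod_cast hs
  have hn' : (0 : ℝ) < n := by exact_mod_cast hn
  -- This absorbs log s ≤ s - 1 into 2 s log R; the remaining log R accounts for the third multiple.
  have hl2 : 1 / 2 ≤ Real.log R := by
    have := Real.log_two_gt_d9
    have := Real.log_le_log two_pos hR
    linarith
  have h1 : Real.log n ≤ Real.log s + Real.log R := by
    rw [← Real.log_mul (by linarith) (by linarith)]
    exact Real.log_le_log hn' (by linarith)
  have h2 := Real.log_le_sub_one_of_pos (show (0 : ℝ) < s by linarith)
  nlinarith [mul_nonneg (sub_nonneg.2 hs') (show 0 ≤ Real.log R by linarith)]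

end Rate

end SparseRegression

end

/-! ### Choice of constants and conclusion. -/

open SparseRegression in
theorem mainTheorem11 (σmin σmax a : ℝ) (hσmin : 0 < σmin) (hσmax : 0 < σmax) (ha : 0 < a) :
    ∃ c : ℝ, 0 < c ∧
      ∀ (α : ℝ), 0 < α → α < 1 →
      ∀ (n d : ℕ) (Cx C₁ : ℝ), 0 < Cx → 0 < C₁ →
      -- the law of the design
      ∀ (PX : Measure (SparseRegression.Vec d)), IsProbabilityMeasure PX →
      Integrable (fun x => ‖x‖ ^ 2) PX → ∫ x, ‖x‖ ^ 2 ∂PX < Cx ^ 2 →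
      -- the true parameter
      ∀ (θ₀ : SparseRegression.Vec d) (σ₀ : ℝ), 0 < σ₀ →
      (2 * σmin)⁻¹ < σ₀ ^ 2 → σ₀ ^ 2 < (2 * σmax)⁻¹ →
      1 ≤ SparseRegression.l0Norm θ₀ → SparseRegression.l0Norm θ₀ < n → n < d →
      -- the tuning parameters
      ∀ (τ b : ℝ), τ = 1 / (Cx * √(n * d)) → b = 1 / √n →
      SparseRegression.l1Norm θ₀ ≤ C₁ - 2 * d * τ →
      -- the sample
      ∀ {Ω : Type*} [MeasurableSpace Ω] (μ : Measure Ω), IsProbabilityMeasure μ →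
      ∀ (Z : Fin n → Ω → ℝ × SparseRegression.Vec d), iIndepFun Z μ →
      (∀ i, HasLaw (Z i) (SparseRegression.modelLaw PX θ₀ σ₀) μ) →
      ∀ (ε : ℝ), ε = SparseRegression.rate c n d (SparseRegression.l0Norm θ₀) Cx C₁ →
      1 - 2 / (n * ε) ≤ μ.real {ω |
        ∫⁻ p, ENNReal.ofReal (SparseRegression.hellingerSq
              (SparseRegression.modelLaw PX p.1 p.2) (SparseRegression.modelLaw PX θ₀ σ₀))
            ∂(SparseRegression.fractionalPosterior (SparseRegression.prior d τ C₁ a b) α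
              (fun i => Z i ω))
          ≤ ENNReal.ofReal (SparseRegression.kappa α * ε) ∧
        ∫⁻ p, ENNReal.ofReal (SparseRegression.tvDist
              (SparseRegression.modelLaw PX p.1 p.2) (SparseRegression.modelLaw PX θ₀ σ₀) ^ 2)
            ∂(SparseRegression.fractionalPosterior (SparseRegression.prior d τ C₁ a b) α
              (fun i => Z i ω))
          ≤ ENNReal.ofReal (4 * (α + 1) / ((1 - α) * α) * ε)} := by
  obtain ⟨K, hK⟩ : ∃ K, K = |Real.log ((Real.Gamma a)⁻¹ * (1 / σmax) ^ (-a - 1)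
    * Real.exp (-(2 * σmin)) * (2 * σmin)⁻¹)| := ⟨_, rfl⟩
  have hK0 : 0 ≤ K := hK ▸ abs_nonneg _
  -- Half of this constant times J = s* log R must pay for the evidence apart from the design term:
  -- 8J for translation, 3(a/2 + 1)J for powers of n, and bounded losses K + 8σmin + 3/2, paid using
  -- 2J ≥ 1.
  refine ⟨2 * (2 * (K + 8 * σmin + 2) + 8 + 3 * (a / 2 + 1)), by positivity, ?_⟩
  intro α hα0 hα1 n d Cx C₁ hCx hC₁ PX hPX hint hCxlt θ₀ σ₀ hσ₀ hσlo hσhi hs1 hsn hnd τ b hτ hb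
    hθ₀ Ω _ μ hμ Z hZ hlaw ε hε
  have hn : 0 < n := by omega
  have hd : 0 < d := by omega
  have hn' : (0 : ℝ) < n := by exact_mod_cast hn
  have hd' : (0 : ℝ) < d := by exact_mod_cast hd
  have hs' : (1 : ℝ) ≤ l0Norm θ₀ := by exact_mod_cast hs1
  have hsn' : (l0Norm θ₀ : ℝ) ≤ n := by exact_mod_cast hsn.le
  have hnd' : (n : ℝ) ≤ d := by exact_mod_cast hnd.le
  have hτ0 : 0 < τ := by rw [hτ]; positivity
  have hb0 : 0 < b := by rw [hb]; positivity
  have hV : 0 < σ₀ ^ 2 := by positivity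
  -- the effective signal-to-scale ratio
  obtain ⟨R, hR⟩ : ∃ R, R = Cx * C₁ * √(n * d) / l0Norm θ₀ := ⟨_, rfl⟩
  have hRτ : R * (l0Norm θ₀ * τ) = C₁ := by
    rw [hR, hτ]
    field_simp
  -- The margin 2dτ in the assumption on θ₀ also forces the ball to be large; this yields s* R ≥ 2d
  -- and R ≥ 2.
  have hC₁τ : 2 * d * τ ≤ C₁ := by linarith [l1Norm_nonneg θ₀]
  have hsR : 2 * (d : ℝ) ≤ l0Norm θ₀ * R := by
    refine le_of_mul_le_mul_right ?_ hτ0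
    linarith
  have hR2 : 2 ≤ R := by
    by_contra! hlt
    nlinarith
  obtain ⟨J, hJ⟩ : ∃ J, J = l0Norm θ₀ * Real.log R := ⟨_, rfl⟩
  have hJ2 : 1 / 2 ≤ J := by
    have h1 := Real.log_two_gt_d9
    have h2 := Real.log_le_log two_pos hR2
    rw [hJ]
    nlinarith
  have hlogn : Real.log n ≤ 3 * J := hJ ▸ log_le_three_mul hs1 hR2 (by linarith) hn
  have hnε : n * ε = 2 * (2 * (K + 8 * σmin + 2) + 8 + 3 * (a / 2 + 1)) * J := by
    rw [hε, rate, ← hR, hJ]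
    field_simp
  have hnε0 : 0 < n * ε := by rw [hnε]; positivity
  have hε0 : 0 < ε := pos_of_mul_pos_right hnε0 hn'.le
  -- the shrinkage factor
  obtain ⟨η, hη⟩ : ∃ η, η = Real.exp (-(2 * σmin / d)) := ⟨_, rfl⟩
  have hη0 : 0 < η := hη ▸ Real.exp_pos _
  have hη1 : η ≤ 1 := by
    rw [hη, Real.exp_le_one_iff, neg_nonpos]
    positivity
  -- From x ≤ exp(x) at x = 4σmin/d. It brings the mean of the design term below 1/2 even when d is
  -- small compared with σmin, while η^(4d) = exp(-8σmin) stays constant.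
  have hη2 : η ^ 2 * (4 * σmin) ≤ d := by
    have h1 : η ^ 2 * Real.exp (4 * σmin / d) = 1 := by
      rw [hη, ← Real.exp_nat_mul, ← Real.exp_add, Real.exp_eq_one_iff]
      push_cast
      ring
    have h2 : 4 * σmin / d ≤ Real.exp (4 * σmin / d) := by
      linarith [Real.add_one_le_exp (4 * σmin / d)]
    rw [div_le_iff₀ hd'] at h2
    calc η ^ 2 * (4 * σmin) ≤ η ^ 2 * (Real.exp (4 * σmin / d) * d) := by gcongr
      _ = (d : ℝ) := by rw [← mul_assoc, h1, one_mul]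
  have hVinv : (σ₀ ^ 2)⁻¹ ≤ 2 * σmin := by
    rw [inv_le_comm₀ hV (by positivity)]
    exact hσlo.le
  have hkC : (η * τ) ^ 2 / σ₀ ^ 2 * (n * Cx ^ 2) ≤ 1 / 2 := by
    have hτ2 : τ ^ 2 * (n * Cx ^ 2) = 1 / d := by
      rw [hτ, div_pow, mul_pow, Real.sq_sqrt (by positivity)]
      field_simp
    calc (η * τ) ^ 2 / σ₀ ^ 2 * (n * Cx ^ 2)
        = η ^ 2 * (σ₀ ^ 2)⁻¹ * (τ ^ 2 * (n * Cx ^ 2)) := by ring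
      _ ≤ η ^ 2 * (2 * σmin) * (1 / d) := by
        rw [hτ2]
        gcongr
      _ ≤ 1 / 2 := by
        rw [mul_one_div, div_le_div_iff₀ hd' two_pos]
        linarith
  -- the deterministic bound off the exceptional event
  have hprior1 := prior_univ_le_one d τ C₁ ha hb0
  have hpriorpos := prior_ae_pos d τ C₁ ha hb0
  have hgood : ∀ z : Fin n → ℝ × Vec d,
      z ∉ {z | ENNReal.ofReal (Real.exp (n * ε / 2))
          ≤ exponentialMoment PX θ₀ σ₀ α (prior d τ C₁ a b) z}
        ∪ {z : Fin n → ℝ × Vec d | ENNReal.ofReal (n * ε / 2)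
          ≤ ENNReal.ofReal ((η * τ) ^ 2 / σ₀ ^ 2 * ∑ i, ‖(z i).2‖ ^ 2)} →
      ∫⁻ p, ENNReal.ofReal (hellingerSq (modelLaw PX p.1 p.2) (modelLaw PX θ₀ σ₀))
          ∂(fractionalPosterior (prior d τ C₁ a b) α z) ≤ ENNReal.ofReal (kappa α * ε) ∧
      ∫⁻ p, ENNReal.ofReal (tvDist (modelLaw PX p.1 p.2) (modelLaw PX θ₀ σ₀) ^ 2)
          ∂(fractionalPosterior (prior d τ C₁ a b) α z)
        ≤ ENNReal.ofReal (4 * (α + 1) / ((1 - α) * α) * ε) := by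
    intro z hz
    rw [Set.mem_union, not_or] at hz
    have hG : exponentialMoment PX θ₀ σ₀ α (prior d τ C₁ a b) z
        < ENNReal.ofReal (Real.exp (n * ε / 2)) := lt_of_not_ge hz.1
    have hU : ENNReal.ofReal ((η * τ) ^ 2 / σ₀ ^ 2 * ∑ i, ‖(z i).2‖ ^ 2)
        < ENNReal.ofReal (n * ε / 2) := lt_of_not_ge hz.2
    rw [ENNReal.ofReal_lt_ofReal_iff (by positivity)] at hU
    refine posterior_risk_le PX hn θ₀ hσ₀ hα0 hα1 _ hpriorpos hε0 z hG.le ?_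
    have hS : 2 * σ₀ ^ 2 ≤ 1 / σmax := by
      have : (2 * σmax)⁻¹ = 1 / σmax / 2 := by field_simp
      linarith
    refine le_trans (ENNReal.ofReal_le_ofReal ?_) (lintegral_likelihoodRatio_prior_ge hn hd hτ0
      hη0 hη1 hθ₀ hα0 hα1 hσ₀ ha hb0 hS z)
    have h1 := prod_student_factor_ge hd θ₀ (L := 2 * σmin) hτ0 hR2
      (by linarith [mul_pos hd' hτ0])
    have h2 := inverseGamma_factor_ge hσmin hσmax ha hn hσlo
    rw [← hη, ← hJ] at h1
    rw [← hK, ← hb] at h2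
    -- Turns the factor 1/2 into an exponential, so that only exponents have to be compared.
    have h3 : Real.exp (-1) ≤ 1 / 2 := by
      rw [Real.exp_neg, one_div]
      exact inv_anti₀ two_pos (by linarith [Real.add_one_le_exp (1 : ℝ)])
    generalize (η * τ) ^ 2 / σ₀ ^ 2 * ∑ i, ‖(z i).2‖ ^ 2 = U at hU ⊢
    calc Real.exp (-(n * ε / 2 + α * (n * ε / 2)))
        ≤ Real.exp (-(4 * (2 * σmin) + 8 * J)) * (Real.exp (-(1 / 2)) * (Real.exp (-(α * U))
          * Real.exp (-1))) * Real.exp (-(K + (a / 2 + 1) * Real.log n)) := by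
          rw [← Real.exp_add, ← Real.exp_add, ← Real.exp_add, ← Real.exp_add]
          refine Real.exp_le_exp.2 ?_
          have h4 : α * U ≤ α * (n * ε / 2) := by gcongr
          have h5 : (a / 2 + 1) * Real.log n ≤ (a / 2 + 1) * (3 * J) := by gcongr
          have h6 : 0 ≤ (K + 8 * σmin + 2) * (2 * J - 1) :=
            mul_nonneg (by positivity) (by linarith)
          rw [hnε] at h4 ⊢
          linarith
      _ ≤ _ := by
          rw [div_eq_mul_one_div (Real.exp (-(α * U)))]
          gcongr
  -- transfer to the sample
  have hpi : HasLaw (fun ω i => Z i ω) (Measure.pi fun _ : Fin n => modelLaw PX θ₀ σ₀) μ :=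
    hZ.hasLaw_pi hlaw
  have hbad := pi_modelLaw_exceptional_le (n := n) PX θ₀ hσ₀ hα0 hα1 (prior d τ C₁ a b) hprior1
    hpriorpos (k := (η * τ) ^ 2 / σ₀ ^ 2) (by positivity) hnε0 hint hCxlt hkC
  set bad : Set (Fin n → ℝ × Vec d) :=
    {z | ENNReal.ofReal (Real.exp (n * ε / 2))
        ≤ exponentialMoment PX θ₀ σ₀ α (prior d τ C₁ a b) z}
      ∪ {z : Fin n → ℝ × Vec d | ENNReal.ofReal (n * ε / 2)
        ≤ ENNReal.ofReal ((η * τ) ^ 2 / σ₀ ^ 2 * ∑ i, ‖(z i).2‖ ^ 2)} with hbaddef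
  have hbadμ : μ ((fun ω i => Z i ω) ⁻¹' bad) ≤ ENNReal.ofReal (2 / (n * ε)) := by
    rw [← hpi.map_eq] at hbad
    -- This inequality holds for arbitrary sets, so measurability of `bad` is not needed.
    exact (Measure.le_map_apply hpi.aemeasurable _).trans hbad
  have hreal : μ.real ((fun ω i => Z i ω) ⁻¹' bad) ≤ 2 / (n * ε) :=
    ENNReal.toReal_le_of_le_ofReal (by positivity) hbadμ
  set good : Set Ω := _ with hgooddef
  change 1 - 2 / (n * ε) ≤ μ.real good
  -- Covering the whole space and using subadditivity avoids complements, hence measurability of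
  -- `good`.
  have hcover : (Set.univ : Set Ω) ⊆ good ∪ (fun ω i => Z i ω) ⁻¹' bad := by
    intro ω _
    by_cases hω : (fun i => Z i ω) ∈ bad
    · exact Or.inr hω
    · exact Or.inl (hgood _ hω)
  have h1 : (1 : ℝ) ≤ μ.real good + μ.real ((fun ω i => Z i ω) ⁻¹' bad) := by
    rw [← probReal_univ (μ := μ)]
    exact (measureReal_mono hcover).trans (measureReal_union_le _ _)
  linarith
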